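/- **Setting.** Let $(\mathscr{A},\mathscr{H},D)$ be a $p$-summable spectral triple, $p>0$. That is, $\mathscr{A}$ is a unital $*$-algebra represented by bounded operators on the (separable) complex Hilbert space $\mathscr{H}$, and $D$ is a selfadjoint unbounded operator on $\mathscr{H}$ with compact resolvent such that, for all $a\in\mathscr{A}$, we have $a(\operatorname{dom}(D))\subseteq\operatorname{dom}(D)$ and $[D,a]$ extends to a bounded operator on $\mathscr{H}$ (still denoted $[D,a]$); $p$-summability means that the partial inverse $D^{-1}$ (equal to $0$ on $\ker D$) lies in $\mathscr{L}_{p,\infty}$. Here $\mathscr{L}(\mathscr{H})$ is the algebra of bounded operators and, for $r>0$, the weak Schatten class $\mathscr{L}_{r,\infty}$ consists of the compact operators $T$ whose singular values $\mu_0(T)\geq\mu_1(T)\geq\cdots$ satisfy $\mu_j(T)=O(j^{-1/r})$, with quasi-norm $\|T\|_{r,\infty}=\sup_{j\geq0}(j+1)^{1/r}\mu_j(T)$. Let $\Pi_0$ be the orthogonal projection onto $\ker D$. For $q\geq 0$ the bounded operator $|D|^{-q}$ is defined by functional calculus with the convention $|D|^{-q}=0$ on $\ker D$ (so that $|D|^0=1-\Pi_0$),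 and $F=D|D|^{-1}$ is the sign of $D$ (equal to $0$ on $\ker D$). **Lemma (Factorization Lemma).** Let $\alpha,\beta,\gamma\in[0,1]$ be such that either $\beta+\gamma<\alpha+1$, or $\beta+\gamma=\alpha+1$ and $\max(\beta,\gamma)<1$. Then there is a bounded linear operator $\Phi=\Phi^{\alpha}_{\beta,\gamma}:\mathscr{L}(\mathscr{H})\to\mathscr{L}(\mathscr{H})$ with the following properties. (i) For all $a\in\mathscr{A}$, $$\big[|D|^{-\alpha},a\big]=|D|^{-\beta}\,\Phi\big([D,a]\big)\,|D|^{-\gamma}+|D|^{-(\alpha+1)}F[D,a]\Pi_0+\Pi_0[D,a]F|D|^{-(\alpha+1)}.$$ (ii) Suppose that $\beta+\gamma<\alpha+1$. If $\max(\beta,\gamma)<1$, then $\Phi$ gives rise to a continuous linear operator $\Phi:\mathscr{L}(\mathscr{H})\to\mathscr{L}_{r,\infty}$ with $r=(1+\alpha-\beta-\gamma)^{-1}p$. If $\max(\beta,\gamma)=1$, then this holds for every $r>(1+\alpha-\beta-\gamma)^{-1}p$. In both cases the range of $\Phi$ is contained in the ideal of compact operators. -/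

import Mathlib

open scoped NNReal ENNReal

noncomputable section

/-! ## Singular values and weak Schatten classes -/

section WeakSchatten

variable {H : Type*} [NormedAddCommGroup H] [InnerProductSpace ℂ H]

/-- The `(j+1)`-th singular value `μ_j(T) = min {‖T - R‖ ; rk R ≤ j}`. For a compact operator `T`
on a Hilbert space this is the `(j+1)`-th eigenvalue of `|T|`, counted with multiplicity. -/
def singularVal (T : H →L[ℂ] H) (j : ℕ) : ℝ :=
  sInf {c : ℝ | ∃ R : H →L[ℂ] H, (R : H →ₗ[ℂ] H).rank ≤ (j : Cardinal) ∧ c = ‖T - R‖}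

/-- The weak Schatten class `L_{r,∞}`: compact operators with `μ_j(T) = O(j^{-1/r})`. -/
def weakSchatten (H : Type*) [NormedAddCommGroup H] [InnerProductSpace ℂ H] (r : ℝ) :
    Set (H →L[ℂ] H) :=
  {T | IsCompactOperator T ∧
    (fun j : ℕ => singularVal T j) =O[Filter.atTop] (fun j : ℕ => (j : ℝ) ^ (-(1 / r)))}

/-- The quasi-norm `‖T‖_{r,∞} = sup_j (j+1)^{1/r} μ_j(T)`, with values in `[0,∞]`. -/
def weakSchattenNorm (r : ℝ) (T : H →L[ℂ] H) : ℝ≥0∞ :=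
  ⨆ j : ℕ, ENNReal.ofReal (((j : ℝ) + 1) ^ (1 / r) * singularVal T j)

/-- `Φ` gives rise to a bounded (equivalently, continuous) linear operator from `L(H)` to the
quasi-normed space `L_{r,∞}`. -/
def BoundedIntoWeakSchatten (Φ : (H →L[ℂ] H) →L[ℂ] (H →L[ℂ] H)) (r : ℝ) : Prop :=
  (∀ T, Φ T ∈ weakSchatten H r) ∧ ∃ C : ℝ≥0, ∀ T, weakSchattenNorm r (Φ T) ≤ C * ‖T‖ₑ

end WeakSchatten

/-! ## Spectral triples -/

/-- An unbounded operator has compact resolvent if `(D - z)⁻¹` exists as a compact operator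
for some complex number `z`. -/
def HasCompactResolvent {H : Type*} [NormedAddCommGroup H] [InnerProductSpace ℂ H]
    (D : H →ₗ.[ℂ] H) : Prop :=
  ∃ (z : ℂ) (R : H →L[ℂ] H), IsCompactOperator R ∧
    (∀ y : H, ∃ h : R y ∈ D.domain, D ⟨R y, h⟩ - z • R y = y) ∧
    (∀ x : D.domain, R (D x - z • (x : H)) = x)

/-- A (unital) spectral triple `(A, H, D)`. -/
structure SpectralTriple (A : Type*) [Ring A] [StarRing A] [Algebra ℂ A]
    (H : Type*) [NormedAddCommGroup H] [InnerProductSpace ℂ H] [CompleteSpace H] where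
  /-- The representation of the `*`-algebra by bounded operators. -/
  π : A →⋆ₐ[ℂ] (H →L[ℂ] H)
  /-- The unbounded selfadjoint operator. -/
  D : H →ₗ.[ℂ] H
  isSelfAdjoint : IsSelfAdjoint D
  compactResolvent : HasCompactResolvent D
  map_domain : ∀ (a : A), ∀ x ∈ D.domain, π a x ∈ D.domain
  comm_bounded : ∀ a : A, ∃ B : H →L[ℂ] H, ∀ x : D.domain,
    B x = D ⟨π a x, map_domain a x x.2⟩ - π a (D x)

namespace SpectralTriple

variable {A : Type*} [Ring A] [StarRing A] [Algebra ℂ A]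
  {H : Type*} [NormedAddCommGroup H] [InnerProductSpace ℂ H] [CompleteSpace H]
  (S : SpectralTriple A H)

/-- The commutator `[D, a]`, extended from the dense domain of `D` to a bounded operator. -/
def comm (a : A) : H →L[ℂ] H := (S.comm_bounded a).choose

theorem comm_apply (a : A) (x : S.D.domain) :
    S.comm a x = S.D ⟨S.π a x, S.map_domain a x x.2⟩ - S.π a (S.D x) :=
  (S.comm_bounded a).choose_spec x

/-- The subspace `ker (D - l)`, i.e. the set of `x` in the domain of `D` with `D x = l x`. -/
def eigenspace (l : ℝ) : Submodule ℂ H :=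
  S.D.graph.comap (LinearMap.prod LinearMap.id ((l : ℂ) • LinearMap.id))

theorem mem_eigenspace {l : ℝ} {x : H} :
    x ∈ S.eigenspace l ↔ ∃ h : x ∈ S.D.domain, S.D ⟨x, h⟩ = (l : ℂ) • x := by
  simp only [eigenspace, Submodule.mem_comap, LinearPMap.mem_graph_iff]
  constructor
  · rintro ⟨⟨y, hy⟩, rfl, h2⟩
    exact ⟨hy, h2⟩
  · rintro ⟨h, h2⟩
    exact ⟨⟨x, h⟩, rfl, h2⟩

theorem isClosed_eigenspace (l : ℝ) : IsClosed (S.eigenspace l : Set H) := by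
  have h : IsClosed (S.D.graph : Set (H × H)) := S.isSelfAdjoint.isClosed
  exact h.preimage (f := fun x : H => (x, (l : ℂ) • x)) (by fun_prop)

instance (l : ℝ) : CompleteSpace (S.eigenspace l) :=
  (S.isClosed_eigenspace l).completeSpace_coe

theorem inner_eigenspace {l m : ℝ} (hlm : l ≠ m) {x y : H} (hx : x ∈ S.eigenspace l)
    (hy : y ∈ S.eigenspace m) : inner ℂ x y = 0 := by
  obtain ⟨hx, ex⟩ := S.mem_eigenspace.1 hx
  obtain ⟨hy, ey⟩ := S.mem_eigenspace.1 hy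
  have h := LinearPMap.adjoint_isFormalAdjoint S.isSelfAdjoint.dense_domain
  rw [LinearPMap.isSelfAdjoint_def.1 S.isSelfAdjoint] at h
  have h1 := h ⟨x, hx⟩ ⟨y, hy⟩
  rw [ex, ey, inner_smul_left, inner_smul_right, Complex.conj_ofReal] at h1
  have h2 : ((l : ℂ) - m) * inner ℂ x y = 0 := by rw [sub_mul]; exact sub_eq_zero.2 h1
  rcases mul_eq_zero.1 h2 with h3 | h3
  · exact absurd (by exact_mod_cast sub_eq_zero.1 h3) hlm
  · exact h3

theorem orthogonalFamily :
    OrthogonalFamily ℂ (fun l => S.eigenspace l) (fun l => (S.eigenspace l).subtypeₗᵢ) :=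
  fun _ _ hlm x y => S.inner_eigenspace hlm x.2 y.2

/-- The orthogonal projection onto `ker (D - l)`. -/
def eigenProj (l : ℝ) : H →L[ℂ] H := (S.eigenspace l).starProjection

/-- The orthogonal projection `Π₀` onto `ker D`. -/
def kerProj : H →L[ℂ] H := S.eigenProj 0

theorem norm_sq_sum_eigenProj (f : ℝ → ℝ) (x : H) (s : Finset ℝ) :
    ‖∑ l ∈ s, (f l : ℂ) • S.eigenProj l x‖ ^ 2 = ∑ l ∈ s, (f l) ^ 2 * ‖S.eigenProj l x‖ ^ 2 := by
  have h := S.orthogonalFamily.norm_sum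
    (fun l => (f l : ℂ) • (S.eigenspace l).orthogonalProjectionOnto x) s
  refine Eq.trans ?_ (h.trans ?_)
  · rfl
  · refine Finset.sum_congr rfl fun l _ => ?_
    rw [norm_smul, mul_pow, Complex.norm_real, Real.norm_eq_abs, sq_abs]
    rfl

theorem sum_norm_sq_eigenProj_le (x : H) (s : Finset ℝ) :
    ∑ l ∈ s, ‖S.eigenProj l x‖ ^ 2 ≤ ‖x‖ ^ 2 := by
  have h1 := S.norm_sq_sum_eigenProj (fun _ => 1) x s
  simp only [Complex.ofReal_one, one_smul, one_pow, one_mul] at h1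
  have h2 : inner ℂ (∑ l ∈ s, S.eigenProj l x) x
      = ((∑ l ∈ s, ‖S.eigenProj l x‖ ^ 2 : ℝ) : ℂ) := by
    rw [sum_inner]
    push_cast
    refine Finset.sum_congr rfl fun l _ => ?_
    have h3 := Submodule.starProjection_inner_eq_zero (K := S.eigenspace l) x
      (S.eigenProj l x) (Submodule.starProjection_apply_mem _ _)
    rw [inner_sub_left, sub_eq_zero] at h3
    have h4 : inner ℂ (S.eigenProj l x) (S.eigenProj l x)
        = ((‖S.eigenProj l x‖ : ℂ)) ^ 2 := inner_self_eq_norm_sq_to_K _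
    rw [← h4, ← inner_conj_symm, h3]
    exact inner_conj_symm _ _
  have h5 := norm_inner_le_norm (𝕜 := ℂ) (∑ l ∈ s, S.eigenProj l x) x
  rw [h2, ← h1, Complex.norm_real, Real.norm_eq_abs, abs_of_nonneg (by positivity)] at h5
  rw [← h1]
  have h6 : ‖∑ l ∈ s, S.eigenProj l x‖ ≤ ‖x‖ := by
    by_contra hc
    have := norm_nonneg x
    nlinarith
  gcongr

/-- The function `f` is bounded on the set of eigenvalues of `D`. -/
def BoundedOnSpectrum (f : ℝ → ℝ) : Prop :=
  ∃ C : ℝ, ∀ l : ℝ, S.eigenspace l ≠ ⊥ → |f l| ≤ C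

theorem sum_bound {f : ℝ → ℝ} {C : ℝ} (hC : ∀ l : ℝ, S.eigenspace l ≠ ⊥ → |f l| ≤ C)
    (x : H) (l : ℝ) : (f l) ^ 2 * ‖S.eigenProj l x‖ ^ 2 ≤ C ^ 2 * ‖S.eigenProj l x‖ ^ 2 := by
  by_cases hl : S.eigenspace l = ⊥
  · have : S.eigenProj l x = 0 := by
      have h : S.eigenProj l x ∈ S.eigenspace l := Submodule.starProjection_apply_mem _ _
      rw [hl] at h
      exact (Submodule.mem_bot ℂ).1 h
    simp [this]
  · have h := hC l hl
    gcongr ?_ * _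
    rw [← sq_abs (f l)]
    gcongr

theorem summable_eigenProj {f : ℝ → ℝ} (hf : S.BoundedOnSpectrum f) (x : H) :
    Summable fun l : ℝ => (f l : ℂ) • S.eigenProj l x := by
  obtain ⟨C, hC⟩ := hf
  refine (S.orthogonalFamily.summable_iff_norm_sq_summable
    (fun l => (f l : ℂ) • (S.eigenspace l).orthogonalProjectionOnto x)).2 ?_
  have h1 : Summable fun l : ℝ => ‖S.eigenProj l x‖ ^ 2 :=
    summable_of_sum_le (fun _ => by positivity) (S.sum_norm_sq_eigenProj_le x)
  refine (h1.mul_left (C ^ 2)).of_nonneg_of_le (fun _ => by positivity) fun l => ?_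
  refine le_trans (le_of_eq ?_) (S.sum_bound hC x l)
  rw [norm_smul, mul_pow, Complex.norm_real, Real.norm_eq_abs, sq_abs]
  rfl

theorem norm_tsum_eigenProj_le {f : ℝ → ℝ} (hf : S.BoundedOnSpectrum f) :
    ∃ C : ℝ, ∀ x : H, ‖∑' l : ℝ, (f l : ℂ) • S.eigenProj l x‖ ≤ C * ‖x‖ := by
  obtain ⟨C, hC⟩ := id hf
  refine ⟨|C|, fun x => ?_⟩
  refine le_of_tendsto (S.summable_eigenProj hf x).hasSum.norm (Filter.Eventually.of_forall ?_)
  intro s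
  refine abs_le_of_sq_le_sq' ?_ (by positivity) |>.2
  rw [S.norm_sq_sum_eigenProj, mul_pow, sq_abs]
  calc _ ≤ ∑ l ∈ s, C ^ 2 * ‖S.eigenProj l x‖ ^ 2 :=
        Finset.sum_le_sum fun l _ => S.sum_bound hC x l
    _ = C ^ 2 * ∑ l ∈ s, ‖S.eigenProj l x‖ ^ 2 := by rw [Finset.mul_sum]
    _ ≤ C ^ 2 * ‖x‖ ^ 2 := by
        gcongr
        exact S.sum_norm_sq_eigenProj_le x s

open Classical in
/-- Functional calculus for `D`: the bounded operator `f(D) = ∑_l f(l) P_l`, where `l` runs over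
the eigenvalues of `D`, `P_l` is the orthogonal projection onto `ker (D - l)`, the sum converges
strongly, and `f` is bounded on the set of eigenvalues (if it is not, the value is `0`). -/
def funCalc (f : ℝ → ℝ) : H →L[ℂ] H :=
  if hf : S.BoundedOnSpectrum f then
    LinearMap.mkContinuousOfExistsBound
      { toFun := fun x => ∑' l : ℝ, (f l : ℂ) • S.eigenProj l x
        map_add' := fun x y => by
          rw [← (S.summable_eigenProj hf x).tsum_add (S.summable_eigenProj hf y)]
          simp only [map_add, smul_add]
        map_smul' := fun c x => by
          rw [RingHom.id_apply, ← (S.summable_eigenProj hf x).tsum_const_smul c]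
          simp only [map_smul, smul_comm c] }
      (S.norm_tsum_eigenProj_le hf)
  else 0

theorem funCalc_apply {f : ℝ → ℝ} (hf : S.BoundedOnSpectrum f) (x : H) :
    S.funCalc f x = ∑' l : ℝ, (f l : ℂ) • S.eigenProj l x := by
  rw [funCalc, dif_pos hf]
  rfl

theorem funCalc_apply_of_mem {f : ℝ → ℝ} (hf : S.BoundedOnSpectrum f) {l : ℝ} {x : H}
    (hx : x ∈ S.eigenspace l) : S.funCalc f x = (f l : ℂ) • x := by
  rw [S.funCalc_apply hf, tsum_eq_single l]
  · rw [eigenProj, Submodule.starProjection_eq_self_iff.2 hx]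
  · intro m hm
    have : S.eigenProj m x = 0 := by
      rw [eigenProj, Submodule.starProjection_apply_eq_zero_iff]
      exact fun y hy => S.inner_eigenspace hm hy hx
    rw [this, smul_zero]

/-- As `D` has compact resolvent, its non-zero eigenvalues stay away from `0`. -/
theorem exists_gap : ∃ c : ℝ, 0 < c ∧ ∀ l : ℝ, S.eigenspace l ≠ ⊥ → l ≠ 0 → c ≤ |l| := by
  by_contra! hcon
  choose! l hl hl0 hlc using fun n : ℕ => hcon (1 / ((n : ℝ) + 1)) (by positivity)
  have hx : ∀ n, ∃ x ∈ S.eigenspace (l n), ‖x‖ = 1 := fun n => by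
    obtain ⟨x, hx, hx0⟩ := (Submodule.ne_bot_iff _).1 (hl n)
    refine ⟨((‖x‖⁻¹ : ℝ) : ℂ) • x, Submodule.smul_mem _ _ hx, ?_⟩
    rw [norm_smul, Complex.norm_real, norm_inv, norm_norm, inv_mul_cancel₀ (norm_ne_zero_iff.2 hx0)]
  choose x hx hx1 using hx
  have hlim : Filter.Tendsto l Filter.atTop (nhds 0) :=
    squeeze_zero_norm (fun n => (hlc n).le) tendsto_one_div_add_atTop_nhds_zero_nat
  obtain ⟨z, R, hR, -, hRD⟩ := S.compactResolvent
  have hRx : ∀ n, ((l n : ℂ) - z) • R (x n) = x n := fun n => by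
    obtain ⟨hd, he⟩ := S.mem_eigenspace.1 (hx n)
    have := hRD ⟨x n, hd⟩
    rw [he, ← sub_smul, map_smul] at this
    exact this
  have hK := hR.isCompact_closure_image_closedBall (𝕜₁ := ℂ) 1
  obtain ⟨y, -, φ, hφ, hy⟩ := hK.tendsto_subseq (x := fun n => R (x n))
    (fun n => subset_closure ⟨x n, by simp [hx1 n], rfl⟩)
  have hw : Filter.Tendsto (fun n => x (φ n)) Filter.atTop (nhds (((0 : ℝ) - z : ℂ) • y)) := by
    have h1 : Filter.Tendsto (fun n => ((l (φ n) : ℂ) - z)) Filter.atTop (nhds ((0 : ℝ) - z : ℂ)) :=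
      ((Complex.continuous_ofReal.tendsto 0).comp (hlim.comp hφ.tendsto_atTop)).sub_const z
    refine (h1.smul hy).congr fun n => hRx (φ n)
  set w := (((0 : ℝ) - z : ℂ) • y)
  have hw1 : ‖w‖ = 1 := by
    refine tendsto_nhds_unique hw.norm ?_
    simp only [hx1]
    exact tendsto_const_nhds
  have horth : ∀ m, inner ℂ (x m) w = 0 := fun m => by
    refine tendsto_nhds_unique ((tendsto_const_nhds (x := x m)).inner hw) ?_
    refine tendsto_const_nhds.congr' ?_
    have h1 : ∀ᶠ n in Filter.atTop, l (φ n) ≠ l m :=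
      (hlim.comp hφ.tendsto_atTop).eventually_ne (hl0 m).symm
    filter_upwards [h1] with n hn
    exact (S.inner_eigenspace hn.symm (hx m) (hx (φ n))).symm
  have hww : inner ℂ w w = 0 := by
    refine tendsto_nhds_unique (hw.inner (tendsto_const_nhds (x := w))) ?_
    simp only [horth]
    exact tendsto_const_nhds
  rw [inner_self_eq_zero] at hww
  simp [hww] at hw1

/-- The function `l ↦ |l|^{-q}`, with value `0` at `l = 0`. -/
def absNegPowFun (q l : ℝ) : ℝ := if l = 0 then 0 else |l| ^ (-q)

theorem bounded_absNegPowFun {q : ℝ} (hq : 0 ≤ q) : S.BoundedOnSpectrum (absNegPowFun q) := by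
  obtain ⟨c, hc, h⟩ := S.exists_gap
  refine ⟨c ^ (-q), fun l hl => ?_⟩
  unfold absNegPowFun
  split_ifs with h0
  · simp only [abs_zero]; positivity
  · rw [abs_of_nonneg (by positivity)]
    exact Real.rpow_le_rpow_of_nonpos hc (h l hl h0) (by linarith)

theorem bounded_inv : S.BoundedOnSpectrum (fun l => l⁻¹) := by
  obtain ⟨c, hc, h⟩ := S.exists_gap
  refine ⟨c⁻¹, fun l hl => ?_⟩
  by_cases h0 : l = 0
  · simp [h0, hc.le]
  · rw [abs_inv]
    exact inv_anti₀ hc (h l hl h0)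

theorem bounded_sign : S.BoundedOnSpectrum Real.sign :=
  ⟨1, fun l _ => by rcases Real.sign_apply_eq l with h | h | h <;> simp [h]⟩

/-- The operator `|D|^{-q}` for `q ≥ 0`, equal to `0` on `ker D`; thus `|D|^0 = 1 - Π₀`. -/
def absNegPow (q : ℝ) : H →L[ℂ] H := S.funCalc (absNegPowFun q)

/-- The partial inverse of `D`: it is `0` on `ker D` and inverts `D` on `(ker D)ᗮ`. -/
def partialInv : H →L[ℂ] H := S.funCalc (fun l => l⁻¹)

/-- The sign `F = D|D|⁻¹` of `D`; it vanishes on `ker D`. -/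
def sign : H →L[ℂ] H := S.funCalc Real.sign

/-- The triple is `p`-summable if the partial inverse of `D` is in `L_{p,∞}`. -/
def IsSummable (p : ℝ) : Prop := S.partialInv ∈ weakSchatten H p

end SpectralTriple

end

noncomputable section

namespace SpectralTriple

variable {A : Type*} [Ring A] [StarRing A] [Algebra ℂ A]
  {H : Type*} [NormedAddCommGroup H] [InnerProductSpace ℂ H] [CompleteSpace H]
  (S : SpectralTriple A H)

/-! ### Spectral theorem for `D` -/

/-! Between eigenvectors of `D` with eigenvalues `l` and `m`, the commutators `[|D|^{-α}, a]` and
`[D, a]` have the matrix elements of `a` times `|l|^{-α} - |m|^{-α}` and `l - m`. Since the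
eigenspaces span a dense subspace, it suffices to find a bounded map `Φ` that multiplies matrix
elements by `|l|^β |m|^γ (|l|^{-α} - |m|^{-α}) / (l - m)` when `l, m ≠ 0`. The blocks where exactly
one of `l, m` vanishes are supplied by the two terms with `Π₀`.

For `α > 0`, write `|l|^{-α}` as a constant times `∫ t^{1-α} (l² + t²)⁻¹ dt`. The difference of two
resolvents contains `m² - l²`, so division by `l - m` leaves `-(l + m)` and no singularity on the
diagonal. This gives two half kernels, one carrying `l` and the other `m`. Each is an integral of a
function of `(l, t)` times a function of `(m, t)`, that is, an inner product `⟪f l, g m⟫` in `L²(0,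
∞)`. If `f` and `g` are bounded on the spectrum, then `T ↦ V* (1 ⊗ T) W` is the desired multiplier
(`exists_isMultiplier`). The bounds follow from scaling when the powers are balanced
(`exists_bound_balanced`); when the half kernel's own variable has exponent `1`, a weight in `t` and
the spectral gap at `0` are used instead (`exists_bound_unit`, `exists_bound_gap`).

For the Schatten classes, surplus powers are split off the kernel, so that each half of `Φ` becomes
`|D|^{-a} Ψ(·) |D|^{-b}` with `Ψ` bounded. Powers of `|D|⁻¹` inherit rates of finite rank
approximation from `D⁻¹` (`exists_rank_le_absNegPow`), and such rates multiply. As a multiplier is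
determined by its kernel, the same `Φ` serves all rates. -/

theorem inner_D_symm (x y : S.D.domain) : inner ℂ (S.D x) (y : H) = inner ℂ (x : H) (S.D y) := by
  have h := LinearPMap.adjoint_isFormalAdjoint S.isSelfAdjoint.dense_domain
  rw [LinearPMap.isSelfAdjoint_def.1 S.isSelfAdjoint] at h
  exact h x y

/-- The operator `D` has a compact resolvent at some real point. -/
theorem exists_real_resolvent : ∃ (x : ℝ) (K : H →L[ℂ] H), IsCompactOperator K ∧
    ∀ y : H, ∃ h : K y ∈ S.D.domain, S.D ⟨K y, h⟩ - (x : ℂ) • K y = y := by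
  obtain ⟨c, hc, hgap⟩ := S.exists_gap
  have hx : S.eigenspace (c / 2) = ⊥ := by
    by_contra hne
    have := hgap _ hne (by positivity)
    rw [abs_of_pos (by positivity)] at this
    linarith
  obtain ⟨z, R, hR, h1, -⟩ := S.compactResolvent
  refine ⟨c / 2, ?_⟩
  set x : ℂ := ((c / 2 : ℝ) : ℂ) with hxdef
  by_cases hzx : z = x
  · exact ⟨R, hR, fun y => by rw [← hzx]; exact h1 y⟩
  have hd : x - z ≠ 0 := sub_ne_zero.2 (Ne.symm hzx)
  -- Fredholm alternative for `R`: an eigenvector `v` at `(x - z)⁻¹` would make `R v` an eigenvector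
  -- of `D` at `x`. Otherwise `D - x = (1 - (x - z) R) (D - z)` can be inverted.
  rcases hR.hasEigenvalue_or_mem_resolventSet (inv_ne_zero hd) with h | h
  · exfalso
    obtain ⟨v, hv⟩ := h.exists_hasEigenvector
    have hv1 : R v = (x - z)⁻¹ • v := hv.apply_eq_smul
    obtain ⟨hdom, he⟩ := h1 v
    have hmem : R v ∈ S.eigenspace (c / 2) := by
      refine S.mem_eigenspace.2 ⟨hdom, ?_⟩
      have h3 : v = (x - z) • R v := by rw [hv1, smul_inv_smul₀ hd]
      rw [sub_eq_iff_eq_add.1 he]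
      nth_rewrite 1 [h3]
      rw [← add_smul, sub_add_cancel]
    rw [hx, Submodule.mem_bot, hv1, smul_eq_zero] at hmem
    rcases hmem with h3 | h3
    · exact inv_ne_zero hd h3
    · exact hv.2 h3
  · rw [spectrum.mem_resolventSet_iff] at h
    obtain ⟨u, hu⟩ := h
    set Q : H →L[ℂ] H := ((u⁻¹ : (H →L[ℂ] H)ˣ) : H →L[ℂ] H)
    refine ⟨(x - z)⁻¹ • R ∘L Q, ?_, fun y => ?_⟩
    · exact (hR.comp_clm Q).smul _
    obtain ⟨hdom, he⟩ := h1 ((x - z)⁻¹ • Q y)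
    have hK : ((x - z)⁻¹ • R ∘L Q) y = R ((x - z)⁻¹ • Q y) := by simp
    have hQ : (x - z)⁻¹ • Q y - R (Q y) = y := by
      have : (u : H →L[ℂ] H) (Q y) = y := by
        rw [← mul_apply_eq_comp, Units.mul_inv]; rfl
      rw [hu] at this
      simpa [Algebra.algebraMap_eq_smul_one] using this
    refine ⟨hK ▸ hdom, ?_⟩
    simp only [hK]
    rw [sub_eq_iff_eq_add.1 he]
    have h4 : R (Q y) = (x - z) • R ((x - z)⁻¹ • Q y) := by
      rw [map_smul, smul_inv_smul₀ hd]
    refine Eq.trans ?_ hQ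
    rw [h4]
    module

/-- The eigenspaces of `D` span a dense subspace. -/
theorem orthogonal_iSup_eigenspace : (⨆ l, S.eigenspace l)ᗮ = ⊥ := by
  obtain ⟨x, K, hK, h⟩ := S.exists_real_resolvent
  have hsymm : K.IsSymmetric := fun y y' => by
    obtain ⟨h1, e1⟩ := h y
    obtain ⟨h2, e2⟩ := h y'
    have h3 := S.inner_D_symm ⟨K y, h1⟩ ⟨K y', h2⟩
    change inner ℂ (K y) y' = inner ℂ y (K y')
    nth_rewrite 1 [← e2]
    nth_rewrite 2 [← e1]
    rw [inner_sub_left, inner_sub_right, inner_smul_left, inner_smul_right, Complex.conj_ofReal,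
      h3]
  refine le_antisymm ?_ bot_le
  rw [← ContinuousLinearMap.orthogonalComplement_iSup_eigenspaces_eq_bot hK hsymm]
  refine Submodule.orthogonal_le (iSup_le fun m v hv => ?_)
  have hv1 : K v = m • v := Module.End.mem_eigenspace_iff.1 hv
  obtain ⟨h1, e1⟩ := h v
  by_cases hv0 : v = 0
  · rw [hv0]; exact Submodule.zero_mem _
  -- `K` has the left inverse `D - x`, so `0` is not an eigenvalue of it.
  by_cases hm : m = 0
  · refine absurd ?_ hv0
    have h0 : (⟨K v, h1⟩ : S.D.domain) = 0 := Subtype.ext (by simp [hv1, hm])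
    rw [← e1, h0, S.D.map_zero, hv1, hm]
    simp
  have hreal : (starRingEnd ℂ) m = m :=
    hsymm.conj_eigenvalue_eq_self (Module.End.hasEigenvalue_of_hasEigenvector ⟨hv, hv0⟩)
  obtain ⟨r, rfl⟩ := Complex.conj_eq_iff_real.1 hreal
  refine Submodule.mem_iSup_of_mem (x + r⁻¹) (S.mem_eigenspace.2 ?_)
  have hvd : v ∈ S.D.domain := by
    have := S.D.domain.smul_mem (r : ℂ)⁻¹ h1
    rwa [hv1, inv_smul_smul₀ hm] at this
  refine ⟨hvd, ?_⟩
  have h2 : (⟨K v, h1⟩ : S.D.domain) = (r : ℂ) • ⟨v, hvd⟩ := Subtype.ext hv1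
  rw [h2, S.D.map_smul, hv1, smul_comm, ← smul_sub] at e1
  have h3 : S.D ⟨v, hvd⟩ - (x : ℂ) • v = (r : ℂ)⁻¹ • v := by
    nth_rewrite 3 [← e1]
    rw [inv_smul_smul₀ hm]
  rw [sub_eq_iff_eq_add.1 h3]
  push_cast
  module

theorem dense_iSup_eigenspace : Dense ((⨆ l, S.eigenspace l : Submodule ℂ H) : Set H) := by
  rw [Submodule.dense_iff_topologicalClosure_eq_top, Submodule.topologicalClosure_eq_top_iff]
  exact S.orthogonal_iSup_eigenspace

theorem ext_on_eigenspace {B C : H →L[ℂ] H}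
    (h : ∀ l, ∀ x ∈ S.eigenspace l, B x = C x) : B = C := by
  refine ContinuousLinearMap.ext_on (s := ⋃ l, (S.eigenspace l : Set H)) ?_ ?_
  · rw [← Submodule.iSup_eq_span]; exact S.dense_iSup_eigenspace
  · intro x hx
    obtain ⟨l, hl⟩ := Set.mem_iUnion.1 hx
    exact h l x hl

/-- Bounded operators are determined by their matrix elements between eigenvectors of `D`. -/
theorem ext_inner_eigenspace {B C : H →L[ℂ] H}
    (h : ∀ l m, ∀ y ∈ S.eigenspace l, ∀ x ∈ S.eigenspace m, inner ℂ y (B x) = inner ℂ y (C x)) :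
    B = C := by
  refine S.ext_on_eigenspace fun m x hx => ?_
  refine sub_eq_zero.1 ((Submodule.mem_bot ℂ).1 ?_)
  rw [← S.orthogonal_iSup_eigenspace, Submodule.mem_orthogonal]
  intro u hu
  induction hu using Submodule.iSup_induction' with
  | mem l y hy => rw [inner_sub_right, h l m y hy x hx, sub_self]
  | zero => exact inner_zero_left _
  | add u v _ _ hu hv => rw [inner_add_left, hu, hv, add_zero]

/-! ### Functional calculus -/

theorem inner_eigenProj_of_mem {l : ℝ} {y : H} (hy : y ∈ S.eigenspace l) (x : H) :
    inner ℂ y (S.eigenProj l x) = inner ℂ y x := by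
  have h := Submodule.starProjection_inner_eq_zero (K := S.eigenspace l) x y hy
  rw [inner_sub_left, sub_eq_zero] at h
  rw [← inner_conj_symm, ← inner_conj_symm y x, h]
  rfl

theorem eigenProj_apply_mem (l : ℝ) (x : H) : S.eigenProj l x ∈ S.eigenspace l :=
  Submodule.starProjection_apply_mem _ _

theorem inner_funCalc_of_mem {f : ℝ → ℝ} (hf : S.BoundedOnSpectrum f) {l : ℝ} {y : H}
    (hy : y ∈ S.eigenspace l) (x : H) : inner ℂ y (S.funCalc f x) = f l * inner ℂ y x := by
  rw [S.funCalc_apply hf]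
  have h1 := ((S.summable_eigenProj hf x).hasSum.mapL (innerSL ℂ y)).tsum_eq
  simp only [innerSL_apply_apply] at h1
  rw [← h1, tsum_eq_single l]
  · rw [inner_smul_right, S.inner_eigenProj_of_mem hy]
  · intro m hm
    rw [inner_smul_right, S.inner_eigenspace hm.symm hy (S.eigenProj_apply_mem m x), mul_zero]

theorem BoundedOnSpectrum.mul {S : SpectralTriple A H} {f g : ℝ → ℝ} (hf : S.BoundedOnSpectrum f)
    (hg : S.BoundedOnSpectrum g) : S.BoundedOnSpectrum (fun l => f l * g l) := by
  obtain ⟨C, hC⟩ := hf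
  obtain ⟨C', hC'⟩ := hg
  refine ⟨C * C', fun l hl => ?_⟩
  rw [abs_mul]
  exact mul_le_mul (hC l hl) (hC' l hl) (abs_nonneg _) ((abs_nonneg _).trans (hC l hl))

theorem BoundedOnSpectrum.sub {S : SpectralTriple A H} {f g : ℝ → ℝ} (hf : S.BoundedOnSpectrum f)
    (hg : S.BoundedOnSpectrum g) : S.BoundedOnSpectrum (fun l => f l - g l) := by
  obtain ⟨C, hC⟩ := hf
  obtain ⟨C', hC'⟩ := hg
  exact ⟨C + C', fun l hl => (abs_sub _ _).trans (add_le_add (hC l hl) (hC' l hl))⟩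

theorem funCalc_mul {f g : ℝ → ℝ} (hf : S.BoundedOnSpectrum f) (hg : S.BoundedOnSpectrum g) :
    S.funCalc f * S.funCalc g = S.funCalc (fun l => f l * g l) := by
  refine S.ext_on_eigenspace fun l x hx => ?_
  rw [mul_apply_eq_comp, S.funCalc_apply_of_mem hg hx, map_smul,
    S.funCalc_apply_of_mem hf hx, S.funCalc_apply_of_mem (hf.mul hg) hx, smul_smul]
  push_cast
  rw [mul_comm]

theorem funCalc_sub {f g : ℝ → ℝ} (hf : S.BoundedOnSpectrum f) (hg : S.BoundedOnSpectrum g) :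
    S.funCalc f - S.funCalc g = S.funCalc (fun l => f l - g l) := by
  refine S.ext_on_eigenspace fun l x hx => ?_
  rw [_root_.sub_apply, S.funCalc_apply_of_mem hg hx,
    S.funCalc_apply_of_mem hf hx, S.funCalc_apply_of_mem (hf.sub hg) hx, ← sub_smul]
  push_cast
  rfl

theorem norm_funCalc_apply_le {f : ℝ → ℝ} {C : ℝ} (hC0 : 0 ≤ C)
    (hC : ∀ l : ℝ, S.eigenspace l ≠ ⊥ → |f l| ≤ C) (x : H) : ‖S.funCalc f x‖ ≤ C * ‖x‖ := by
  rw [S.funCalc_apply ⟨C, hC⟩]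
  refine le_of_tendsto (S.summable_eigenProj ⟨C, hC⟩ x).hasSum.norm
    (Filter.Eventually.of_forall fun s => ?_)
  refine abs_le_of_sq_le_sq' ?_ (by positivity) |>.2
  rw [S.norm_sq_sum_eigenProj, mul_pow]
  calc _ ≤ ∑ l ∈ s, C ^ 2 * ‖S.eigenProj l x‖ ^ 2 :=
        Finset.sum_le_sum fun l _ => S.sum_bound hC x l
    _ = C ^ 2 * ∑ l ∈ s, ‖S.eigenProj l x‖ ^ 2 := by rw [Finset.mul_sum]
    _ ≤ C ^ 2 * ‖x‖ ^ 2 := by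
        gcongr
        exact S.sum_norm_sq_eigenProj_le x s

theorem norm_funCalc_le {f : ℝ → ℝ} {C : ℝ} (hC0 : 0 ≤ C)
    (hC : ∀ l : ℝ, S.eigenspace l ≠ ⊥ → |f l| ≤ C) : ‖S.funCalc f‖ ≤ C :=
  ContinuousLinearMap.opNorm_le_bound _ hC0 (S.norm_funCalc_apply_le hC0 hC)

/-! ### Matrix elements of the operators in the factorization -/

theorem absNegPow_apply_of_mem {q : ℝ} (hq : 0 ≤ q) {l : ℝ} {x : H} (hx : x ∈ S.eigenspace l) :
    S.absNegPow q x = (absNegPowFun q l : ℂ) • x :=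
  S.funCalc_apply_of_mem (S.bounded_absNegPowFun hq) hx

theorem inner_absNegPow_of_mem {q : ℝ} (hq : 0 ≤ q) {l : ℝ} {y : H} (hy : y ∈ S.eigenspace l)
    (x : H) : inner ℂ y (S.absNegPow q x) = absNegPowFun q l * inner ℂ y x :=
  S.inner_funCalc_of_mem (S.bounded_absNegPowFun hq) hy x

theorem kerProj_apply_of_mem {l : ℝ} {x : H} (hx : x ∈ S.eigenspace l) :
    S.kerProj x = (if l = 0 then 1 else 0 : ℂ) • x := by
  rw [kerProj]
  split_ifs with h
  · subst h
    rw [eigenProj, Submodule.starProjection_eq_self_iff.2 hx, one_smul]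
  · rw [zero_smul, eigenProj, Submodule.starProjection_apply_eq_zero_iff]
    exact fun y hy => S.inner_eigenspace (Ne.symm h) hy hx

theorem inner_kerProj_of_mem {l : ℝ} {y : H} (hy : y ∈ S.eigenspace l) (x : H) :
    inner ℂ y (S.kerProj x) = (if l = 0 then 1 else 0 : ℂ) * inner ℂ y x := by
  rw [kerProj]
  split_ifs with h
  · subst h
    rw [S.inner_eigenProj_of_mem hy, one_mul]
  · rw [S.inner_eigenspace h hy (S.eigenProj_apply_mem 0 x), zero_mul]

/-- Symmetry lets `D` act on the left vector. The factor `l - m` is what the kernel of `Φ` has to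
divide by. -/
theorem inner_comm_of_mem (a : A) {l m : ℝ} {y x : H} (hy : y ∈ S.eigenspace l)
    (hx : x ∈ S.eigenspace m) :
    inner ℂ y (S.comm a x) = ((l : ℂ) - m) * inner ℂ y (S.π a x) := by
  obtain ⟨hx, ex⟩ := S.mem_eigenspace.1 hx
  obtain ⟨hy, ey⟩ := S.mem_eigenspace.1 hy
  have h1 := S.inner_D_symm ⟨y, hy⟩ ⟨S.π a x, S.map_domain a x hx⟩
  rw [S.comm_apply a ⟨x, hx⟩, inner_sub_right, ← h1, ex, ey, map_smul, inner_smul_left,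
    inner_smul_right, Complex.conj_ofReal]
  ring

end SpectralTriple

end

noncomputable section

/-! ### Orthogonal series -/

section OrthogonalSeries

variable {ι E : Type*} [NormedAddCommGroup E] [InnerProductSpace ℂ E]

theorem orthogonalFamily_span_singleton {v : ι → E}
    (hv : Pairwise fun i j => inner ℂ (v i) (v j) = 0) :
    OrthogonalFamily ℂ (fun i => Submodule.span ℂ {v i})
      (fun i => (Submodule.span ℂ {v i}).subtypeₗᵢ) := by
  intro i j hij x y
  obtain ⟨a, ha⟩ := Submodule.mem_span_singleton.1 x.2
  obtain ⟨b, hb⟩ := Submodule.mem_span_singleton.1 y.2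
  change inner ℂ (x : E) (y : E) = 0
  rw [← ha, ← hb, inner_smul_left, inner_smul_right, hv hij, mul_zero, mul_zero]

theorem norm_sq_sum_of_orthogonal {v : ι → E}
    (hv : Pairwise fun i j => inner ℂ (v i) (v j) = 0) (s : Finset ι) :
    ‖∑ i ∈ s, v i‖ ^ 2 = ∑ i ∈ s, ‖v i‖ ^ 2 :=
  (orthogonalFamily_span_singleton hv).norm_sum
    (fun i => ⟨v i, Submodule.mem_span_singleton_self _⟩) s

variable [CompleteSpace E]

theorem summable_of_orthogonal {v : ι → E} (hv : Pairwise fun i j => inner ℂ (v i) (v j) = 0)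
    {M : ℝ} (hM : ∀ s : Finset ι, ∑ i ∈ s, ‖v i‖ ^ 2 ≤ M) : Summable v :=
  ((orthogonalFamily_span_singleton hv).summable_iff_norm_sq_summable
    (fun i => ⟨v i, Submodule.mem_span_singleton_self _⟩)).2
    (summable_of_sum_le (fun _ => by positivity) hM)

theorem norm_tsum_le_of_orthogonal {v : ι → E}
    (hv : Pairwise fun i j => inner ℂ (v i) (v j) = 0)
    {M : ℝ} (hM0 : 0 ≤ M) (hM : ∀ s : Finset ι, ∑ i ∈ s, ‖v i‖ ^ 2 ≤ M ^ 2) :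
    ‖∑' i, v i‖ ≤ M := by
  refine le_of_tendsto (summable_of_orthogonal hv hM).hasSum.norm
    (Filter.Eventually.of_forall fun s => ?_)
  refine abs_le_of_sq_le_sq' ?_ hM0 |>.2
  rw [norm_sq_sum_of_orthogonal hv]
  exact hM s

end OrthogonalSeries

/-! ### Vector-valued `L²` functions of the form `t ↦ f t • x` -/

section TensorLp

open MeasureTheory

variable {X : Type*} [MeasurableSpace X] (ν : Measure X)
  {H : Type*} [NormedAddCommGroup H] [InnerProductSpace ℂ H]

/-- The element `t ↦ f t • x` of `L²(ν; H)`, as a bilinear map. -/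
def tensorLp : H →L[ℂ] Lp ℂ 2 ν →L[ℂ] Lp H 2 ν :=
  (ContinuousLinearMap.lsmul ℂ ℂ : ℂ →L[ℂ] H →L[ℂ] H).flip.compLpL₂ 2 ν

variable {ν}

theorem coeFn_tensorLp (x : H) (f : Lp ℂ 2 ν) : ∀ᵐ t ∂ν, tensorLp ν x f t = f t • x := by
  filter_upwards [((ContinuousLinearMap.lsmul ℂ ℂ : ℂ →L[ℂ] H →L[ℂ] H).flip x).coeFn_compLp f]
    with t ht
  exact ht

theorem inner_tensorLp (x y : H) (f g : Lp ℂ 2 ν) :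
    inner ℂ (tensorLp ν x f) (tensorLp ν y g) = inner ℂ f g * inner ℂ x y := by
  rw [L2.inner_def, L2.inner_def, ← integral_mul_const]
  refine integral_congr_ae ?_
  filter_upwards [coeFn_tensorLp x f, coeFn_tensorLp y g] with t h1 h2
  rw [h1, h2, inner_smul_left, inner_smul_right, RCLike.inner_apply]
  ring

theorem norm_tensorLp (x : H) (f : Lp ℂ 2 ν) : ‖tensorLp ν x f‖ = ‖f‖ * ‖x‖ := by
  have h := inner_tensorLp x x f f
  simp only [inner_self_eq_norm_sq_to_K] at h
  have h2 : ‖tensorLp ν x f‖ ^ 2 = (‖f‖ * ‖x‖) ^ 2 := by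
    rw [mul_pow]
    exact_mod_cast h
  exact (pow_left_inj₀ (norm_nonneg _) (by positivity) two_ne_zero).1 h2

theorem compLp_tensorLp (T : H →L[ℂ] H) (x : H) (f : Lp ℂ 2 ν) :
    T.compLp (tensorLp ν x f) = tensorLp ν (T x) f := by
  refine Lp.ext ?_
  filter_upwards [T.coeFn_compLp (tensorLp ν x f), coeFn_tensorLp x f, coeFn_tensorLp (T x) f]
    with t h1 h2 h3
  rw [h1, h2, h3, map_smul]

end TensorLp

/-! ### Double operator integrals -/

namespace SpectralTriple

open MeasureTheory

variable {A : Type*} [Ring A] [StarRing A] [Algebra ℂ A]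
  {H : Type*} [NormedAddCommGroup H] [InnerProductSpace ℂ H] [CompleteSpace H]
  (S : SpectralTriple A H)

/-- `Ψ` multiplies the matrix elements of operators in the spectral decomposition of `D` by the
kernel `k`. -/
def IsMultiplier (k : ℝ → ℝ → ℝ) (Ψ : (H →L[ℂ] H) →L[ℂ] (H →L[ℂ] H)) : Prop :=
  ∀ (T : H →L[ℂ] H) (l m : ℝ), ∀ y ∈ S.eigenspace l, ∀ x ∈ S.eigenspace m,
    inner ℂ y (Ψ T x) = k l m * inner ℂ y (T x)

variable {S}

/-- This identifies multipliers obtained from different factorizations of one kernel, each proving a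
different approximation rate. -/
theorem IsMultiplier.unique {k : ℝ → ℝ → ℝ} {Ψ Ψ' : (H →L[ℂ] H) →L[ℂ] (H →L[ℂ] H)}
    (h : S.IsMultiplier k Ψ) (h' : S.IsMultiplier k Ψ') : Ψ = Ψ' :=
  ContinuousLinearMap.ext fun T => S.ext_inner_eigenspace fun l m y hy x hx => by
    rw [h T l m y hy x hx, h' T l m y hy x hx]

theorem IsMultiplier.add {k k' : ℝ → ℝ → ℝ} {Ψ Ψ' : (H →L[ℂ] H) →L[ℂ] (H →L[ℂ] H)}
    (h : S.IsMultiplier k Ψ) (h' : S.IsMultiplier k' Ψ') :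
    S.IsMultiplier (fun l m => k l m + k' l m) (Ψ + Ψ') := fun T l m y hy x hx => by
  rw [_root_.add_apply, _root_.add_apply, inner_add_right, h T l m y hy x hx,
    h' T l m y hy x hx]
  push_cast
  ring

theorem IsMultiplier.smul {k : ℝ → ℝ → ℝ} {Ψ : (H →L[ℂ] H) →L[ℂ] (H →L[ℂ] H)}
    (h : S.IsMultiplier k Ψ) (c : ℝ) :
    S.IsMultiplier (fun l m => c * k l m) ((c : ℂ) • Ψ) := fun T l m y hy x hx => by
  rw [_root_.smul_apply, _root_.smul_apply, inner_smul_right, h T l m y hy x hx]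
  push_cast
  ring

theorem IsMultiplier.congr {k k' : ℝ → ℝ → ℝ} {Ψ : (H →L[ℂ] H) →L[ℂ] (H →L[ℂ] H)}
    (h : S.IsMultiplier k Ψ)
    (hk : ∀ l m, S.eigenspace l ≠ ⊥ → S.eigenspace m ≠ ⊥ → k l m = k' l m) :
    S.IsMultiplier k' Ψ := fun T l m y hy x hx => by
  by_cases hl : S.eigenspace l = ⊥
  · rw [hl, Submodule.mem_bot] at hy
    simp [hy]
  by_cases hm : S.eigenspace m = ⊥
  · rw [hm, Submodule.mem_bot] at hx
    simp [hx]
  rw [h T l m y hy x hx, hk l m hl hm]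

/-- The map `T ↦ |D|^{-a} T |D|^{-b}`. -/
def sandwich (S : SpectralTriple A H) (a b : ℝ) : (H →L[ℂ] H) →L[ℂ] (H →L[ℂ] H) :=
  ContinuousLinearMap.mulLeftRight ℂ (H →L[ℂ] H) (S.absNegPow a) (S.absNegPow b)

theorem sandwich_apply (a b : ℝ) (T : H →L[ℂ] H) :
    S.sandwich a b T = S.absNegPow a * T * S.absNegPow b := rfl

theorem IsMultiplier.sandwich {k : ℝ → ℝ → ℝ} {Ψ : (H →L[ℂ] H) →L[ℂ] (H →L[ℂ] H)}
    (h : S.IsMultiplier k Ψ) {a b : ℝ} (ha : 0 ≤ a) (hb : 0 ≤ b) :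
    S.IsMultiplier (fun l m => absNegPowFun a l * k l m * absNegPowFun b m)
      (S.sandwich a b ∘L Ψ) := fun T l m y hy x hx => by
  rw [ContinuousLinearMap.comp_apply, sandwich_apply, mul_apply_eq_comp, mul_apply_eq_comp,
    S.inner_absNegPow_of_mem ha hy, S.absNegPow_apply_of_mem hb hx, map_smul, inner_smul_right,
    h T l m y hy x hx]
  push_cast
  ring

/-! ### Multipliers from kernels that factor through `L²(ν)` -/

section Dilation

variable {X : Type*} [MeasurableSpace X] {ν : Measure X}

theorem inner_tensorLp_eigenProj (S : SpectralTriple A H) (f g : ℝ → Lp ℂ 2 ν) (x y : H) {l m : ℝ}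
    (hlm : l ≠ m) :
    inner ℂ (tensorLp ν (S.eigenProj l x) (f l)) (tensorLp ν (S.eigenProj m y) (g m)) = 0 := by
  rw [inner_tensorLp,
    S.inner_eigenspace hlm (S.eigenProj_apply_mem l x) (S.eigenProj_apply_mem m y), mul_zero]

theorem sum_norm_sq_tensorLp_le {f : ℝ → Lp ℂ 2 ν} {C : ℝ}
    (hC : ∀ l : ℝ, S.eigenspace l ≠ ⊥ → ‖f l‖ ≤ C) (x : H) (s : Finset ℝ) :
    ∑ l ∈ s, ‖tensorLp ν (S.eigenProj l x) (f l)‖ ^ 2 ≤ (C * ‖x‖) ^ 2 := by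
  calc ∑ l ∈ s, ‖tensorLp ν (S.eigenProj l x) (f l)‖ ^ 2
      = ∑ l ∈ s, ‖f l‖ ^ 2 * ‖S.eigenProj l x‖ ^ 2 :=
        Finset.sum_congr rfl fun l _ => by rw [norm_tensorLp, mul_pow]
    _ ≤ ∑ l ∈ s, C ^ 2 * ‖S.eigenProj l x‖ ^ 2 :=
        Finset.sum_le_sum fun l _ => S.sum_bound
          (fun l hl => (abs_of_nonneg (norm_nonneg (f l))).trans_le (hC l hl)) x l
    _ = C ^ 2 * ∑ l ∈ s, ‖S.eigenProj l x‖ ^ 2 := by rw [Finset.mul_sum]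
    _ ≤ (C * ‖x‖) ^ 2 := by
        rw [mul_pow]
        gcongr
        exact S.sum_norm_sq_eigenProj_le x s

theorem summable_tensorLp {f : ℝ → Lp ℂ 2 ν} {C : ℝ}
    (hC : ∀ l : ℝ, S.eigenspace l ≠ ⊥ → ‖f l‖ ≤ C) (x : H) :
    Summable fun l => tensorLp ν (S.eigenProj l x) (f l) :=
  summable_of_orthogonal (fun _ _ hlm => S.inner_tensorLp_eigenProj f f x x hlm)
    (sum_norm_sq_tensorLp_le hC x)

/-- A family of functions `f l ∈ L²(ν)`, bounded on the spectrum of `D`, gives rise to the bounded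
operator `x ↦ (t ↦ f(D)(t) x)` from `H` to `L²(ν; H)`. -/
theorem exists_dilation {f : ℝ → Lp ℂ 2 ν} {C : ℝ} (hC0 : 0 ≤ C)
    (hC : ∀ l : ℝ, S.eigenspace l ≠ ⊥ → ‖f l‖ ≤ C) :
    ∃ V : H →L[ℂ] Lp H 2 ν, ∀ l, ∀ x ∈ S.eigenspace l, V x = tensorLp ν x (f l) := by
  refine ⟨LinearMap.mkContinuous
    { toFun := fun x => ∑' l : ℝ, tensorLp ν (S.eigenProj l x) (f l)
      map_add' := fun x y => by
        rw [← (summable_tensorLp hC x).tsum_add (summable_tensorLp hC y)]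
        simp only [map_add, _root_.add_apply]
      map_smul' := fun c x => by
        rw [RingHom.id_apply, ← (summable_tensorLp hC x).tsum_const_smul c]
        simp only [map_smul, _root_.smul_apply] } C fun x => ?_, fun l x hx => ?_⟩
  · exact norm_tsum_le_of_orthogonal (fun _ _ hlm => S.inner_tensorLp_eigenProj f f x x hlm)
      (by positivity) (sum_norm_sq_tensorLp_le hC x)
  · change ∑' l : ℝ, tensorLp ν (S.eigenProj l x) (f l) = _
    rw [tsum_eq_single l]
    · rw [eigenProj, Submodule.starProjection_eq_self_iff.2 hx]
    · intro m hm
      have : S.eigenProj m x = 0 := by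
        rw [eigenProj, Submodule.starProjection_apply_eq_zero_iff]
        exact fun y hy => S.inner_eigenspace hm hy hx
      rw [this, map_zero, _root_.zero_apply]

/-- A kernel which factorizes through `L²(ν)` defines a bounded multiplier. -/
theorem exists_isMultiplier {k : ℝ → ℝ → ℝ} {f g : ℝ → Lp ℂ 2 ν} {C : ℝ}
    (hf : ∀ l : ℝ, S.eigenspace l ≠ ⊥ → ‖f l‖ ≤ C)
    (hg : ∀ l : ℝ, S.eigenspace l ≠ ⊥ → ‖g l‖ ≤ C)
    (hk : ∀ l m : ℝ, S.eigenspace l ≠ ⊥ → S.eigenspace m ≠ ⊥ → inner ℂ (f l) (g m) = (k l m : ℂ)) :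
    ∃ Ψ, S.IsMultiplier k Ψ := by
  obtain ⟨V, hV⟩ := exists_dilation (abs_nonneg C) fun l hl => (hf l hl).trans (le_abs_self C)
  obtain ⟨W, hW⟩ := exists_dilation (abs_nonneg C) fun l hl => (hg l hl).trans (le_abs_self C)
  -- The map `T ↦ V* (1 ⊗ T) W`, where `1 ⊗ T` applies `T` pointwise on `L²(ν; H)`.
  refine ⟨(ContinuousLinearMap.compL ℂ H (Lp H 2 ν) H V.adjoint) ∘L
    ((ContinuousLinearMap.compL ℂ H (Lp H 2 ν) (Lp H 2 ν)).flip W) ∘L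
    (ContinuousLinearMap.id ℂ (H →L[ℂ] H)).compLpL₂ 2 ν, ?_⟩
  intro T l m y hy x hx
  by_cases hl : S.eigenspace l = ⊥
  · rw [hl, Submodule.mem_bot] at hy
    simp [hy]
  by_cases hm : S.eigenspace m = ⊥
  · rw [hm, Submodule.mem_bot] at hx
    simp only [hx, map_zero, inner_zero_right, mul_zero]
  change inner ℂ y (V.adjoint (T.compLp (W x))) = _
  rw [ContinuousLinearMap.adjoint_inner_right, hV l y hy, hW m x hx, compLp_tensorLp,
    inner_tensorLp, hk l m hl hm]

end Dilation

end SpectralTriple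

end

noncomputable section

/-! ### Approximation by operators of finite rank -/

section Approximation

variable {H : Type*} [NormedAddCommGroup H] [InnerProductSpace ℂ H]

/-- The distance of `T` to the operators of rank at most `j` is at most `C (j + 1)^{-θ}`. -/
def HasApproxOrder (θ C : ℝ) (T : H →L[ℂ] H) : Prop :=
  ∀ j : ℕ, ∃ R : H →L[ℂ] H, (R : H →ₗ[ℂ] H).rank ≤ (j : Cardinal) ∧
    ‖T - R‖ ≤ C * ((j : ℝ) + 1) ^ (-θ)

theorem hasApproxOrder_zero (T : H →L[ℂ] H) : HasApproxOrder 0 ‖T‖ T := fun j =>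
  ⟨0, by simp, by simp⟩

theorem HasApproxOrder.mono {θ θ' C C' : ℝ} {T : H →L[ℂ] H} (h : HasApproxOrder θ C T)
    (hθ : θ' ≤ θ) (hC : C ≤ C') (hC0 : 0 ≤ C') : HasApproxOrder θ' C' T := fun j => by
  obtain ⟨R, hR, hn⟩ := h j
  refine ⟨R, hR, hn.trans (mul_le_mul hC ?_ (by positivity) hC0)⟩
  exact Real.rpow_le_rpow_of_exponent_le (by linarith [(j.cast_nonneg : (0 : ℝ) ≤ j)]) (by linarith)

/-- Sums and products of two operators share the rank budget `j` equally; this is the price in the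
constant. -/
theorem half_add_one_rpow_le (j : ℕ) {θ : ℝ} (hθ : 0 ≤ θ) :
    (((j / 2 : ℕ) : ℝ) + 1) ^ (-θ) ≤ 2 ^ θ * ((j : ℝ) + 1) ^ (-θ) := by
  have h1 : ((j : ℝ) + 1) / 2 ≤ ((j / 2 : ℕ) : ℝ) + 1 := by
    have : j + 1 ≤ 2 * (j / 2) + 2 := by omega
    have h2 : ((j : ℝ) + 1) ≤ 2 * ((j / 2 : ℕ) : ℝ) + 2 := by exact_mod_cast this
    linarith
  calc (((j / 2 : ℕ) : ℝ) + 1) ^ (-θ) ≤ (((j : ℝ) + 1) / 2) ^ (-θ) :=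
        Real.rpow_le_rpow_of_nonpos (by positivity) h1 (by linarith)
    _ = 2 ^ θ * ((j : ℝ) + 1) ^ (-θ) := by
        rw [Real.div_rpow (by positivity) (by norm_num), Real.rpow_neg (by norm_num : (0 : ℝ) ≤ 2),
          div_inv_eq_mul, mul_comm]

theorem rank_add_le_of_half {j : ℕ} {R R' : H →ₗ[ℂ] H} (h : R.rank ≤ ((j / 2 : ℕ) : Cardinal))
    (h' : R'.rank ≤ ((j / 2 : ℕ) : Cardinal)) : (R + R').rank ≤ (j : Cardinal) :=
  (LinearMap.rank_add_le R R').trans ((add_le_add h h').trans (by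
    rw [← Nat.cast_add, Nat.cast_le]; omega))

theorem HasApproxOrder.add {θ C C' : ℝ} (hθ : 0 ≤ θ) (hC : 0 ≤ C) (hC' : 0 ≤ C')
    {T T' : H →L[ℂ] H} (h : HasApproxOrder θ C T) (h' : HasApproxOrder θ C' T') :
    HasApproxOrder θ (2 ^ θ * (C + C')) (T + T') := fun j => by
  obtain ⟨R, hR, hn⟩ := h (j / 2)
  obtain ⟨R', hR', hn'⟩ := h' (j / 2)
  refine ⟨R + R', rank_add_le_of_half hR hR', ?_⟩
  have hj := half_add_one_rpow_le j hθ
  calc ‖T + T' - (R + R')‖ = ‖(T - R) + (T' - R')‖ := by congr 1; abel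
    _ ≤ ‖T - R‖ + ‖T' - R'‖ := norm_add_le _ _
    _ ≤ (C + C') * (((j / 2 : ℕ) : ℝ) + 1) ^ (-θ) := by rw [add_mul]; exact add_le_add hn hn'
    _ ≤ (C + C') * (2 ^ θ * ((j : ℝ) + 1) ^ (-θ)) := by gcongr
    _ = _ := by ring

theorem HasApproxOrder.mul {θ θ' C C' : ℝ} (hθ : 0 ≤ θ) (hθ' : 0 ≤ θ') (hC : 0 ≤ C) (hC' : 0 ≤ C')
    {T T' : H →L[ℂ] H} (h : HasApproxOrder θ C T) (h' : HasApproxOrder θ' C' T') :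
    HasApproxOrder (θ + θ') (2 ^ (θ + θ') * (C * C')) (T * T') := fun j => by
  obtain ⟨R, hR, hn⟩ := h (j / 2)
  obtain ⟨R', hR', hn'⟩ := h' (j / 2)
  -- Chosen so that the error is exactly `(T - R) * (T' - R')`, whence the orders add up.
  refine ⟨R * T' + (T - R) * R', rank_add_le_of_half ?_ ?_, ?_⟩
  · exact (LinearMap.rank_comp_le_left _ _).trans hR
  · exact (LinearMap.rank_comp_le_right _ _).trans hR'
  have hj := half_add_one_rpow_le j (add_nonneg hθ hθ')
  have h0 : (0 : ℝ) < ((j / 2 : ℕ) : ℝ) + 1 := by positivity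
  calc ‖T * T' - (R * T' + (T - R) * R')‖ = ‖(T - R) * (T' - R')‖ := by congr 1; noncomm_ring
    _ ≤ ‖T - R‖ * ‖T' - R'‖ := norm_mul_le _ _
    _ ≤ (C * (((j / 2 : ℕ) : ℝ) + 1) ^ (-θ)) * (C' * (((j / 2 : ℕ) : ℝ) + 1) ^ (-θ')) := by
        gcongr
    _ = (C * C') * (((j / 2 : ℕ) : ℝ) + 1) ^ (-(θ + θ')) := by
        rw [neg_add, Real.rpow_add h0]; ring
    _ ≤ (C * C') * (2 ^ (θ + θ') * ((j : ℝ) + 1) ^ (-(θ + θ'))) := by gcongr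
    _ = _ := by ring

theorem singularVal_le {T R : H →L[ℂ] H} {j : ℕ}
    (hR : (R : H →ₗ[ℂ] H).rank ≤ (j : Cardinal)) : singularVal T j ≤ ‖T - R‖ :=
  csInf_le ⟨0, by rintro _ ⟨R, -, rfl⟩; exact norm_nonneg _⟩ ⟨R, hR, rfl⟩

theorem singularVal_nonneg (T : H →L[ℂ] H) (j : ℕ) : 0 ≤ singularVal T j :=
  Real.sInf_nonneg (by rintro _ ⟨R, -, rfl⟩; exact norm_nonneg _)

theorem exists_of_singularVal_lt {T : H →L[ℂ] H} {j : ℕ} {s : ℝ} (h : singularVal T j < s) :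
    ∃ R : H →L[ℂ] H, (R : H →ₗ[ℂ] H).rank ≤ (j : Cardinal) ∧ ‖T - R‖ < s := by
  have hne : {c : ℝ | ∃ R : H →L[ℂ] H, (R : H →ₗ[ℂ] H).rank ≤ (j : Cardinal) ∧
      c = ‖T - R‖}.Nonempty := ⟨‖T - 0‖, 0, by simp, rfl⟩
  obtain ⟨_, ⟨R, hR, rfl⟩, hs⟩ := exists_lt_of_csInf_lt hne h
  exact ⟨R, hR, hs⟩

theorem HasApproxOrder.singularVal_le {θ C : ℝ} {T : H →L[ℂ] H} (h : HasApproxOrder θ C T)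
    (j : ℕ) : singularVal T j ≤ C * ((j : ℝ) + 1) ^ (-θ) := by
  obtain ⟨R, hR, hn⟩ := h j
  exact (_root_.singularVal_le hR).trans hn

theorem isCompactOperator_of_rank_le {R : H →L[ℂ] H} {j : ℕ}
    (hR : (R : H →ₗ[ℂ] H).rank ≤ (j : Cardinal)) : IsCompactOperator R := by
  have : FiniteDimensional ℂ (LinearMap.range (R : H →ₗ[ℂ] H)) :=
    Module.rank_lt_aleph0_iff.1 (hR.trans_lt Cardinal.natCast_lt_aleph0)
  have h1 : IsCompactOperator (R.codRestrict (LinearMap.range (R : H →ₗ[ℂ] H))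
      fun x => LinearMap.mem_range_self _ x) :=
    isCompactOperator_of_locallyCompactSpace_dom _
  exact h1.clm_comp (LinearMap.range (R : H →ₗ[ℂ] H)).subtypeL

theorem HasApproxOrder.isCompactOperator [CompleteSpace H] {θ C : ℝ} {T : H →L[ℂ] H}
    (h : HasApproxOrder θ C T) (hθ : 0 < θ) : IsCompactOperator T := by
  choose R hR hn using h
  refine isCompactOperator_of_tendsto (l := Filter.atTop) (F := R) ?_
    (Filter.Eventually.of_forall fun j => isCompactOperator_of_rank_le (hR j))
  rw [tendsto_iff_norm_sub_tendsto_zero]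
  have h1 : Filter.Tendsto (fun j : ℕ => C * ((j : ℝ) + 1) ^ (-θ)) Filter.atTop (nhds 0) := by
    have h2 := (tendsto_rpow_neg_atTop hθ).comp
      (Filter.tendsto_atTop_add_const_right _ (1 : ℝ) tendsto_natCast_atTop_atTop)
    simpa using h2.const_mul C
  exact squeeze_zero (fun _ => norm_nonneg _) (fun j => by rw [norm_sub_rev]; exact hn j) h1

/-- The linear map `Φ` takes values in the operators with approximation numbers
`O(j^{-θ})`, with a bound that is linear in the norm. -/
def IsApproximable (θ : ℝ) (Φ : (H →L[ℂ] H) →L[ℂ] (H →L[ℂ] H)) : Prop :=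
  ∃ C : ℝ, 0 ≤ C ∧ ∀ T, HasApproxOrder θ (C * ‖T‖) (Φ T)

theorem isApproximable_zero (θ : ℝ) : IsApproximable θ (0 : (H →L[ℂ] H) →L[ℂ] (H →L[ℂ] H)) :=
  ⟨0, le_rfl, fun _ _ => ⟨0, by simp, by simp⟩⟩

theorem IsApproximable.mono {θ θ' : ℝ} {Φ : (H →L[ℂ] H) →L[ℂ] (H →L[ℂ] H)}
    (h : IsApproximable θ Φ) (hθ : θ' ≤ θ) : IsApproximable θ' Φ := by
  obtain ⟨C, hC, h⟩ := h
  exact ⟨C, hC, fun T => (h T).mono hθ le_rfl (by positivity)⟩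

theorem IsApproximable.add {θ : ℝ} (hθ : 0 ≤ θ) {Φ Φ' : (H →L[ℂ] H) →L[ℂ] (H →L[ℂ] H)}
    (h : IsApproximable θ Φ) (h' : IsApproximable θ Φ') : IsApproximable θ (Φ + Φ') := by
  obtain ⟨C, hC, h⟩ := h
  obtain ⟨C', hC', h'⟩ := h'
  refine ⟨2 ^ θ * (C + C'), by positivity, fun T => ?_⟩
  have := (h T).add hθ (by positivity) (by positivity) (h' T)
  rwa [← add_mul, ← mul_assoc] at this

theorem IsApproximable.smul {θ : ℝ} {Φ : (H →L[ℂ] H) →L[ℂ] (H →L[ℂ] H)}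
    (h : IsApproximable θ Φ) (c : ℂ) : IsApproximable θ (c • Φ) := by
  obtain ⟨C, hC, h⟩ := h
  refine ⟨‖c‖ * C, by positivity, fun T j => ?_⟩
  obtain ⟨R, hR, hn⟩ := h T j
  have hc : ((c • R : H →L[ℂ] H) : H →ₗ[ℂ] H) = (c • LinearMap.id) ∘ₗ (R : H →ₗ[ℂ] H) := rfl
  refine ⟨c • R, ?_, ?_⟩
  · rw [hc]
    exact (LinearMap.rank_comp_le_right _ _).trans hR
  · rw [_root_.smul_apply, ← smul_sub, norm_smul, mul_assoc ‖c‖, mul_assoc ‖c‖]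
    exact mul_le_mul_of_nonneg_left hn (norm_nonneg c)

theorem IsApproximable.boundedIntoWeakSchatten [CompleteSpace H] {r : ℝ} (hr : 0 < r)
    {Φ : (H →L[ℂ] H) →L[ℂ] (H →L[ℂ] H)} (h : IsApproximable (1 / r) Φ) :
    BoundedIntoWeakSchatten Φ r := by
  obtain ⟨C, hC, h⟩ := h
  refine ⟨fun T => ⟨(h T).isCompactOperator (by positivity), ?_⟩, C.toNNReal, fun T => ?_⟩
  · refine Asymptotics.IsBigO.of_bound (C * ‖T‖) ?_
    filter_upwards [Filter.eventually_ge_atTop 1] with j hj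
    rw [Real.norm_of_nonneg (singularVal_nonneg _ _), Real.norm_of_nonneg (by positivity)]
    refine ((h T).singularVal_le j).trans ?_
    gcongr ?_ * ?_
    have : (1 : ℝ) ≤ j := by exact_mod_cast hj
    exact Real.rpow_le_rpow_of_nonpos (by linarith) (by linarith)
      (neg_nonpos.2 (by positivity))
  · refine iSup_le fun j => ?_
    have h1 : ((j : ℝ) + 1) ^ (1 / r) * singularVal (Φ T) j ≤ C * ‖T‖ := by
      have h2 : (0 : ℝ) < (j : ℝ) + 1 := by positivity
      calc ((j : ℝ) + 1) ^ (1 / r) * singularVal (Φ T) j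
          ≤ ((j : ℝ) + 1) ^ (1 / r) * (C * ‖T‖ * ((j : ℝ) + 1) ^ (-(1 / r))) := by
            gcongr
            exact (h T).singularVal_le j
        _ = C * ‖T‖ := by
            rw [mul_comm, mul_assoc, ← Real.rpow_add h2, neg_add_cancel, Real.rpow_zero, mul_one]
    refine (ENNReal.ofReal_le_ofReal h1).trans (le_of_eq ?_)
    rw [ENNReal.ofReal_mul hC, ofReal_norm]
    rfl

end Approximation

/-! ### Approximation orders of the powers of `|D|` -/

namespace SpectralTriple

variable {A : Type*} [Ring A] [StarRing A] [Algebra ℂ A]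
  {H : Type*} [NormedAddCommGroup H] [InnerProductSpace ℂ H] [CompleteSpace H]
  {S : SpectralTriple A H}

theorem absNegPowFun_le {a s : ℝ} (ha : 0 ≤ a) (hs : 0 ≤ s) {l : ℝ} (h : |l⁻¹| ≤ s) :
    |absNegPowFun a l| ≤ s ^ a := by
  unfold absNegPowFun
  split_ifs with h0
  · rw [abs_zero]; positivity
  · rw [abs_of_nonneg (by positivity), Real.rpow_neg (abs_nonneg _),
      ← Real.inv_rpow (abs_nonneg _), ← abs_inv]
    exact Real.rpow_le_rpow (abs_nonneg _) h ha

/-- If `D⁻¹` has distance less than `s` from the operators of rank at most `j`, then `|D|^{-a}` has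
distance at most `s^a` from them. -/
theorem exists_rank_le_absNegPow {a s : ℝ} (ha : 0 ≤ a) (hs : 0 < s) {j : ℕ} {R : H →L[ℂ] H}
    (hR : (R : H →ₗ[ℂ] H).rank ≤ (j : Cardinal)) (hn : ‖S.partialInv - R‖ < s) :
    ∃ R' : H →L[ℂ] H, (R' : H →ₗ[ℂ] H).rank ≤ (j : Cardinal) ∧
      ‖S.absNegPow a - R'‖ ≤ s ^ a := by
  classical
  -- The approximant is `|D|^{-a}` cut off to the spectral subspace where `|D|⁻¹ > s`. The
  -- convention `0⁻¹ = 0` excludes `ker D`.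
  set e : ℝ → ℝ := fun l => if s < |l⁻¹| then 1 else 0 with he
  have hb_e : S.BoundedOnSpectrum e := ⟨1, fun l _ => by simp only [he]; split_ifs <;> simp⟩
  have hb_a := S.bounded_absNegPowFun ha
  -- `G(D)` inverts `D⁻¹` on the cut-off subspace with norm at most `s⁻¹`, so `D⁻¹` is bounded below
  -- by `s` there.
  set G : ℝ → ℝ := fun l => if s < |l⁻¹| then l else 0 with hG
  have hG_le : ∀ l : ℝ, S.eigenspace l ≠ ⊥ → |G l| ≤ s⁻¹ := fun l _ => by
    simp only [hG]
    split_ifs with h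
    · rw [abs_inv] at h
      exact (le_inv_comm₀ hs (inv_pos.1 (hs.trans h))).1 h.le
    · rw [abs_zero]; positivity
  have hb_G : S.BoundedOnSpectrum G := ⟨s⁻¹, hG_le⟩
  refine ⟨S.funCalc fun l => e l * absNegPowFun a l, ?_, ?_⟩
  · set R' := S.funCalc fun l => e l * absNegPowFun a l
    have hfix : S.funCalc G * (S.partialInv * R') = R' := by
      rw [partialInv, S.funCalc_mul S.bounded_inv (hb_e.mul hb_a),
        S.funCalc_mul hb_G (S.bounded_inv.mul (hb_e.mul hb_a))]
      congr 1
      funext l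
      simp only [hG, he]
      split_ifs with h
      · have : l ≠ 0 := by
          rintro rfl
          simp only [inv_zero, abs_zero] at h
          linarith
        field_simp
      · simp
    have hlow : ∀ v ∈ LinearMap.range (R' : H →ₗ[ℂ] H), s * ‖v‖ ≤ ‖S.partialInv v‖ := by
      rintro _ ⟨x, rfl⟩
      have h1 := S.norm_funCalc_apply_le (inv_nonneg.2 hs.le) hG_le (S.partialInv (R' x))
      have h2 : S.funCalc G (S.partialInv (R' x)) = R' x := congrArg (fun B => B x) hfix
      rw [h2, inv_mul_eq_div, le_div_iff₀ hs, mul_comm] at h1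
      exact h1
    refine le_trans ?_ hR
    -- `R` is injective on the range of `R'`: a nonzero `v` there with `R v = 0` would satisfy `s
    -- ‖v‖ ≤ ‖D⁻¹ v‖ < s ‖v‖`.
    refine LinearMap.rank_le_of_injective (((R : H →ₗ[ℂ] H).domRestrict
      (LinearMap.range (R' : H →ₗ[ℂ] H))).codRestrict (LinearMap.range (R : H →ₗ[ℂ] H))
      fun x => LinearMap.mem_range_self _ _) ?_
    rw [← LinearMap.ker_eq_bot, LinearMap.ker_eq_bot']
    rintro ⟨v, hv⟩ hv0
    have hRv : R v = 0 := congrArg Subtype.val hv0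
    by_contra hne
    have hvne : v ≠ 0 := fun h => hne (Subtype.ext h)
    have h1 := hlow v hv
    have h2 := (S.partialInv - R).le_opNorm v
    rw [_root_.sub_apply, hRv, sub_zero] at h2
    have h3 : ‖S.partialInv - R‖ * ‖v‖ < s * ‖v‖ :=
      mul_lt_mul_of_pos_right hn (norm_pos_iff.2 hvne)
    linarith
  · rw [absNegPow, S.funCalc_sub hb_a (hb_e.mul hb_a)]
    refine S.norm_funCalc_le (by positivity) fun l _ => ?_
    simp only [he]
    split_ifs with h
    · rw [one_mul, sub_self, abs_zero]; positivity
    · rw [zero_mul, sub_zero]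
      exact absNegPowFun_le ha hs.le (not_lt.1 h)

theorem exists_singularVal_partialInv_lt {p : ℝ} (hp : 0 < p) (hS : S.IsSummable p) :
    ∃ C : ℝ, 0 < C ∧ ∀ j : ℕ, singularVal S.partialInv j < C * ((j : ℝ) + 1) ^ (-(1 / p)) := by
  obtain ⟨C, hC⟩ := hS.2.bound
  obtain ⟨N, hN⟩ := Filter.eventually_atTop.1 hC
  have hq : 0 ≤ 1 / p := by positivity
  -- The first summand pays for replacing `j` by `j + 1` when `j > N`, the second covers `j ≤ N`,
  -- and the final `1` makes the inequality strict, since the infimum in `singularVal` is not known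
  -- to be attained.
  refine ⟨2 ^ (1 / p) * |C| + ‖S.partialInv‖ * ((N : ℝ) + 1) ^ (1 / p) + 1, by positivity,
    fun j => ?_⟩
  have hj : (0 : ℝ) < (j : ℝ) + 1 := by positivity
  have hpos : 0 < ((j : ℝ) + 1) ^ (-(1 / p)) := by positivity
  have h1 : 0 ≤ 2 ^ (1 / p) * |C| * ((j : ℝ) + 1) ^ (-(1 / p)) := by positivity
  have h2 : 0 ≤ ‖S.partialInv‖ * ((N : ℝ) + 1) ^ (1 / p) * ((j : ℝ) + 1) ^ (-(1 / p)) := by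
    positivity
  rw [add_mul, add_mul, one_mul]
  by_cases hjN : N + 1 ≤ j
  · have h3 := hN j (by omega)
    rw [Real.norm_of_nonneg (singularVal_nonneg _ _), Real.norm_of_nonneg (by positivity)] at h3
    have h4 : (j : ℝ) ^ (-(1 / p)) ≤ 2 ^ (1 / p) * ((j : ℝ) + 1) ^ (-(1 / p)) := by
      have hj1 : (1 : ℝ) ≤ j := by exact_mod_cast (by omega : 1 ≤ j)
      calc (j : ℝ) ^ (-(1 / p)) ≤ (((j : ℝ) + 1) / 2) ^ (-(1 / p)) :=
            Real.rpow_le_rpow_of_nonpos (by positivity) (by linarith) (by linarith)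
        _ = _ := by
            rw [Real.div_rpow (by positivity) (by norm_num),
              Real.rpow_neg (by norm_num : (0 : ℝ) ≤ 2), div_inv_eq_mul, mul_comm]
    have h5 : C * (j : ℝ) ^ (-(1 / p)) ≤ 2 ^ (1 / p) * |C| * ((j : ℝ) + 1) ^ (-(1 / p)) :=
      calc C * (j : ℝ) ^ (-(1 / p)) ≤ |C| * (j : ℝ) ^ (-(1 / p)) := by
            gcongr; exact le_abs_self C
        _ ≤ |C| * (2 ^ (1 / p) * ((j : ℝ) + 1) ^ (-(1 / p))) := by gcongr
        _ = _ := by ring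
    linarith
  · have h3 : singularVal S.partialInv j ≤ ‖S.partialInv‖ := by
      simpa using singularVal_le (T := S.partialInv) (R := 0) (j := j) (by simp)
    have h4 : (1 : ℝ) ≤ ((N : ℝ) + 1) ^ (1 / p) * ((j : ℝ) + 1) ^ (-(1 / p)) := by
      rw [Real.rpow_neg hj.le, ← div_eq_mul_inv, one_le_div (by positivity)]
      refine Real.rpow_le_rpow hj.le ?_ hq
      have : j ≤ N := by omega
      have : (j : ℝ) ≤ N := by exact_mod_cast this
      linarith
    have h5 : ‖S.partialInv‖ ≤
        ‖S.partialInv‖ * ((N : ℝ) + 1) ^ (1 / p) * ((j : ℝ) + 1) ^ (-(1 / p)) := by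
      rw [mul_assoc]
      exact le_mul_of_one_le_right (norm_nonneg _) h4
    linarith

theorem exists_hasApproxOrder_absNegPow {p : ℝ} (hp : 0 < p) (hS : S.IsSummable p) {a : ℝ}
    (ha : 0 ≤ a) : ∃ C : ℝ, 0 ≤ C ∧ HasApproxOrder (a / p) C (S.absNegPow a) := by
  obtain ⟨C, hC, h⟩ := exists_singularVal_partialInv_lt hp hS
  refine ⟨C ^ a, by positivity, fun j => ?_⟩
  obtain ⟨R, hR, hn⟩ := exists_of_singularVal_lt (h j)
  obtain ⟨R', hR', hn'⟩ := exists_rank_le_absNegPow ha (by positivity) hR hn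
  refine ⟨R', hR', hn'.trans (le_of_eq ?_)⟩
  rw [Real.mul_rpow hC.le (by positivity), ← Real.rpow_mul (by positivity)]
  congr 2
  field_simp

theorem isApproximable_sandwich {p : ℝ} (hp : 0 < p) (hS : S.IsSummable p) {a b : ℝ}
    (ha : 0 ≤ a) (hb : 0 ≤ b) (Ψ : (H →L[ℂ] H) →L[ℂ] (H →L[ℂ] H)) :
    IsApproximable ((a + b) / p) (S.sandwich a b ∘L Ψ) := by
  obtain ⟨C, hC, h⟩ := exists_hasApproxOrder_absNegPow hp hS ha
  obtain ⟨C', hC', h'⟩ := exists_hasApproxOrder_absNegPow hp hS hb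
  have hθ : 0 ≤ a / p := by positivity
  have hθ' : 0 ≤ b / p := by positivity
  refine ⟨2 ^ (a / p + b / p) * (2 ^ (a / p) * (C * ‖Ψ‖) * C'), by positivity, fun T => ?_⟩
  -- The middle factor contributes only its norm, at order `0`.
  have h1 := (h.mul hθ le_rfl hC (norm_nonneg _) (hasApproxOrder_zero (Ψ T))).mul
    (by simpa using hθ) hθ' (by positivity) hC' h'
  rw [add_zero, ← add_div] at h1
  refine h1.mono le_rfl ?_ (by positivity)
  rw [← add_div]
  calc _ ≤ 2 ^ ((a + b) / p) * (2 ^ (a / p) * (C * (‖Ψ‖ * ‖T‖)) * C') := by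
        gcongr
        exact Ψ.le_opNorm T
    _ = _ := by ring

end SpectralTriple

end

noncomputable section

open MeasureTheory Set

/-! ### The integrals `∫ t^u (x² + t²)^{-v} dt` -/

section RadialIntegrals

/-- The condition on `u` governs `t → 0`, the one on `u - 2 * v` governs `t → ∞`. -/
theorem integrableOn_rpow_mul_one_add_sq {u v : ℝ} (hu : -1 < u) (hv : 0 ≤ v)
    (huv : u - 2 * v < -1) :
    IntegrableOn (fun t : ℝ => t ^ u * (1 + t ^ 2) ^ (-v)) (Ioi 0) := by
  have hmeas : Measurable fun t : ℝ => t ^ u * (1 + t ^ 2) ^ (-v) := by fun_prop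
  rw [← Ioc_union_Ioi_eq_Ioi zero_le_one]
  refine IntegrableOn.union ?_ ?_
  · have h1 : IntegrableOn (fun t : ℝ => t ^ u) (Ioc 0 1) :=
      (intervalIntegrable_iff_integrableOn_Ioc_of_le zero_le_one).1
        (intervalIntegral.intervalIntegrable_rpow' hu)
    refine Integrable.mono' h1 hmeas.aestronglyMeasurable ?_
    filter_upwards [ae_restrict_mem measurableSet_Ioc] with t ht
    have ht0 : 0 < t := ht.1
    rw [Real.norm_of_nonneg (by positivity)]
    refine mul_le_of_le_one_right (by positivity) ?_
    exact Real.rpow_le_one_of_one_le_of_nonpos (by nlinarith) (neg_nonpos.2 hv)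
  · refine Integrable.mono' (integrableOn_Ioi_rpow_of_lt huv zero_lt_one)
      hmeas.aestronglyMeasurable ?_
    filter_upwards [ae_restrict_mem measurableSet_Ioi] with t ht
    have ht0 : 0 < t := zero_lt_one.trans ht
    rw [Real.norm_of_nonneg (by positivity), sub_eq_add_neg, Real.rpow_add ht0]
    gcongr ?_ * ?_
    calc (1 + t ^ 2) ^ (-v) ≤ (t ^ 2) ^ (-v) :=
          Real.rpow_le_rpow_of_nonpos (by positivity) (by linarith) (by linarith)
      _ = t ^ (-(2 * v)) := by
          rw [← Real.rpow_natCast, ← Real.rpow_mul ht0.le]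
          congr 1
          push_cast
          ring

/-- Homogeneity under `t ↦ |x| t` is the source of all bounds that are uniform in the eigenvalue. -/
theorem radial_scaling {u v x t : ℝ} (hx : x ≠ 0) (ht : 0 < t) :
    (|x| * t) ^ u * (x ^ 2 + (|x| * t) ^ 2) ^ (-v)
      = |x| ^ (u - 2 * v) * (t ^ u * (1 + t ^ 2) ^ (-v)) := by
  have hx' : 0 < |x| := abs_pos.2 hx
  have h1 : x ^ 2 + (|x| * t) ^ 2 = |x| ^ (2 : ℝ) * (1 + t ^ 2) := by
    rw [mul_pow, ← sq_abs x, Real.rpow_two]; ring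
  rw [h1, Real.mul_rpow hx'.le ht.le, Real.mul_rpow (by positivity) (by positivity),
    ← Real.rpow_mul hx'.le, sub_eq_add_neg, Real.rpow_add hx', mul_neg]
  ring

theorem integrableOn_radial {u v x : ℝ} (hu : -1 < u) (hv : 0 ≤ v) (huv : u - 2 * v < -1)
    (hx : x ≠ 0) : IntegrableOn (fun t : ℝ => t ^ u * (x ^ 2 + t ^ 2) ^ (-v)) (Ioi 0) := by
  have h1 := integrableOn_Ioi_comp_mul_left_iff (fun t : ℝ => t ^ u * (x ^ 2 + t ^ 2) ^ (-v)) 0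
    (abs_pos.2 hx)
  rw [mul_zero] at h1
  rw [← h1]
  refine ((integrableOn_rpow_mul_one_add_sq hu hv huv).const_mul (|x| ^ (u - 2 * v))).congr ?_
  filter_upwards [ae_restrict_mem measurableSet_Ioi] with t ht
  exact (radial_scaling hx ht).symm

theorem integral_radial {u v x : ℝ} (hx : x ≠ 0) :
    ∫ t in Ioi (0 : ℝ), t ^ u * (x ^ 2 + t ^ 2) ^ (-v)
      = |x| ^ (u + 1 - 2 * v) * ∫ t in Ioi (0 : ℝ), t ^ u * (1 + t ^ 2) ^ (-v) := by
  have hx' : 0 < |x| := abs_pos.2 hx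
  have h1 := integral_comp_mul_left_Ioi (fun t : ℝ => t ^ u * (x ^ 2 + t ^ 2) ^ (-v)) 0 hx'
  rw [mul_zero, setIntegral_congr_fun measurableSet_Ioi
    (fun t ht => radial_scaling hx ht), integral_const_mul, smul_eq_mul] at h1
  have h2 : |x| ^ (u + 1 - 2 * v) = |x| * |x| ^ (u - 2 * v) := by
    rw [show u + 1 - 2 * v = 1 + (u - 2 * v) by ring, Real.rpow_add hx', Real.rpow_one]
  rw [h2, mul_assoc, h1, mul_inv_cancel_left₀ hx'.ne']

theorem sq_rpow_half {t : ℝ} (ht : 0 ≤ t) (x : ℝ) : (t ^ (x / 2)) ^ 2 = t ^ x := by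
  rw [← Real.rpow_natCast, ← Real.rpow_mul ht]
  congr 1
  push_cast
  ring

theorem inv_sq_eq_rpow {x : ℝ} (hx : 0 ≤ x) : (x⁻¹) ^ 2 = x ^ (-2 : ℝ) := by
  rw [Real.rpow_neg hx, Real.rpow_two, inv_pow]

end RadialIntegrals

/-! ### The kernels -/

/-- The integral `∫ t^{1-α} (l² + t²)⁻¹ (m² + t²)⁻¹ dt`. -/
def resolventIntegral (α l m : ℝ) : ℝ :=
  ∫ t in Ioi (0 : ℝ), t ^ (1 - α) * (l ^ 2 + t ^ 2)⁻¹ * (m ^ 2 + t ^ 2)⁻¹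

/-- The constant `∫ t^{1-α} (1 + t²)⁻¹ dt`. -/
def resolventConst (α : ℝ) : ℝ := ∫ t in Ioi (0 : ℝ), t ^ (1 - α) * (1 + t ^ 2) ^ (-1 : ℝ)

/-- The kernel `l |l|^β |m|^γ ∫ t^{1-α} (l² + t²)⁻¹ (m² + t²)⁻¹ dt`, vanishing for `l = 0` and for
`m = 0`. -/
def halfKernel (α β γ l m : ℝ) : ℝ :=
  l * SpectralTriple.absNegPowFun (-β) l * SpectralTriple.absNegPowFun (-γ) m *
    resolventIntegral α l m

theorem resolventIntegral_comm (α l m : ℝ) :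
    resolventIntegral α l m = resolventIntegral α m l := by
  unfold resolventIntegral
  congr 1
  funext t
  ring

theorem resolventConst_pos {α : ℝ} (h0 : 0 < α) (h2 : α < 2) : 0 < resolventConst α := by
  refine (setIntegral_pos_iff_support_of_nonneg_ae ?_
    (integrableOn_rpow_mul_one_add_sq (by linarith) zero_le_one (by linarith))).2 ?_
  · filter_upwards [ae_restrict_mem measurableSet_Ioi] with t ht
    have ht0 : 0 < t := ht
    simp only [Pi.zero_apply]
    positivity
  · have h1 : Function.support (fun t : ℝ => t ^ (1 - α) * (1 + t ^ 2) ^ (-1 : ℝ)) ∩ Ioi 0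
        = Ioi 0 := by
      refine inter_eq_right.2 fun t ht => ?_
      have ht0 : 0 < t := ht
      exact (by positivity : t ^ (1 - α) * (1 + t ^ 2) ^ (-1 : ℝ) ≠ 0)
    rw [h1]
    simp

/-- The resolvent identity turns the integrand into `t^{1-α} ((l² + t²)⁻¹ - (m² + t²)⁻¹)`, and each
term is evaluated by scaling. -/
theorem sub_mul_resolventIntegral {α l m : ℝ} (h0 : 0 < α) (h2 : α < 2) (hl : l ≠ 0)
    (hm : m ≠ 0) : (m ^ 2 - l ^ 2) * resolventIntegral α l m
      = resolventConst α * (|l| ^ (-α) - |m| ^ (-α)) := by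
  have hi : ∀ x : ℝ, x ≠ 0 →
      IntegrableOn (fun t : ℝ => t ^ (1 - α) * (x ^ 2 + t ^ 2) ^ (-1 : ℝ)) (Ioi 0) := fun x hx =>
    integrableOn_radial (by linarith) zero_le_one (by linarith) hx
  have he : ∀ x : ℝ, x ≠ 0 → ∫ t in Ioi (0 : ℝ), t ^ (1 - α) * (x ^ 2 + t ^ 2) ^ (-1 : ℝ)
      = |x| ^ (-α) * resolventConst α := fun x hx => by
    rw [integral_radial hx, resolventConst]
    congr 2
    ring
  rw [mul_sub, mul_comm _ (|l| ^ (-α)), mul_comm _ (|m| ^ (-α)), ← he l hl, ← he m hm,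
    ← integral_sub (hi l hl) (hi m hm), resolventIntegral, ← integral_const_mul]
  refine setIntegral_congr_fun measurableSet_Ioi fun t ht => ?_
  have hl' : 0 < l ^ 2 + t ^ 2 := by positivity
  have hm' : 0 < m ^ 2 + t ^ 2 := by positivity
  simp only [Real.rpow_neg_one]
  field_simp
  ring

namespace SpectralTriple

theorem absNegPowFun_zero_right (q : ℝ) : absNegPowFun q 0 = 0 := if_pos rfl

theorem absNegPowFun_of_ne {l : ℝ} (hl : l ≠ 0) (q : ℝ) : absNegPowFun q l = |l| ^ (-q) :=
  if_neg hl

theorem absNegPowFun_mul (p q l : ℝ) :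
    absNegPowFun p l * absNegPowFun q l = absNegPowFun (p + q) l := by
  by_cases hl : l = 0
  · simp [hl, absNegPowFun_zero_right]
  · rw [absNegPowFun_of_ne hl, absNegPowFun_of_ne hl, absNegPowFun_of_ne hl,
      ← Real.rpow_add (abs_pos.2 hl), neg_add]

theorem mul_absNegPowFun (q l : ℝ) :
    l * absNegPowFun (-q) l = l.sign * absNegPowFun (-(q + 1)) l := by
  by_cases hl : l = 0
  · simp [hl]
  · rw [absNegPowFun_of_ne hl, absNegPowFun_of_ne hl, neg_neg, neg_neg,
      Real.rpow_add (abs_pos.2 hl), Real.rpow_one]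
    have h : l.sign * |l| = l := by
      rcases lt_or_gt_of_ne hl with h | h
      · rw [Real.sign_of_neg h, abs_of_neg h]; ring
      · rw [Real.sign_of_pos h, abs_of_pos h, one_mul]
    rw [mul_left_comm, h, mul_comm]

/-- Raising the exponents of the kernel releases factors `|D|^{-a}` and `|D|^{-b}` on the two sides;
these carry the compactness. -/
theorem halfKernel_eq (α β γ a b l m : ℝ) :
    halfKernel α β γ l m
      = absNegPowFun a l * halfKernel α (β + a) (γ + b) l m * absNegPowFun b m := by
  unfold halfKernel
  have h1 : absNegPowFun (-β) l = absNegPowFun a l * absNegPowFun (-(β + a)) l := by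
    rw [absNegPowFun_mul]; congr 1; ring
  have h2 : absNegPowFun (-γ) m = absNegPowFun b m * absNegPowFun (-(γ + b)) m := by
    rw [absNegPowFun_mul]; congr 1; ring
  rw [h1, h2]
  ring

/-! ### Factorization of the kernels -/

section Factorization

theorem inner_eq_integral_of_ae {X : Type*} [MeasurableSpace X] {ν : Measure X} {F G : Lp ℂ 2 ν}
    {f g : X → ℝ} (hF : F =ᵐ[ν] fun t => (f t : ℂ)) (hG : G =ᵐ[ν] fun t => (g t : ℂ)) :
    inner ℂ F G = ((∫ t, f t * g t ∂ν : ℝ) : ℂ) := by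
  rw [L2.inner_def, ← integral_complex_ofReal]
  refine integral_congr_ae ?_
  filter_upwards [hF, hG] with t h1 h2
  rw [h1, h2, RCLike.inner_apply, Complex.conj_ofReal]
  push_cast
  ring

theorem exists_lp_of_integrable_sq {X : Type*} [MeasurableSpace X] {ν : Measure X} {f : X → ℝ}
    (hf : Measurable f) (hi : Integrable (fun t => f t ^ 2) ν) :
    ∃ F : Lp ℂ 2 ν, F =ᵐ[ν] fun t => (f t : ℂ) := by
  have h : MemLp (fun t => (f t : ℂ)) 2 ν := ((memLp_two_iff_integrable_sq
    hf.aestronglyMeasurable).2 hi).ofReal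
  exact ⟨h.toLp, h.coeFn_toLp⟩

theorem norm_le_of_ae {X : Type*} [MeasurableSpace X] {ν : Measure X} {F : Lp ℂ 2 ν}
    {f : X → ℝ} (hF : F =ᵐ[ν] fun t => (f t : ℂ)) {C : ℝ} (hC : ∫ t, f t ^ 2 ∂ν ≤ C) :
    ‖F‖ ≤ √C := by
  have h := inner_eq_integral_of_ae hF hF
  have h2 : inner ℂ F F = ((‖F‖ : ℝ) : ℂ) ^ 2 := inner_self_eq_norm_sq_to_K _
  rw [h2] at h
  have h1 : ‖F‖ ^ 2 = ∫ t, f t * f t ∂ν := by exact_mod_cast h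
  simp only [← sq] at h1
  exact Real.le_sqrt_of_sq_le (h1 ▸ hC)

variable {A : Type*} [Ring A] [StarRing A] [Algebra ℂ A]
  {H : Type*} [NormedAddCommGroup H] [InnerProductSpace ℂ H] [CompleteSpace H]
  {S : SpectralTriple A H}

theorem exists_isMultiplier_of_integral {X : Type*} [MeasurableSpace X] {ν : Measure X}
    {k : ℝ → ℝ → ℝ} {f g : ℝ → X → ℝ} {C C' : ℝ}
    (hfm : ∀ l, Measurable (f l)) (hgm : ∀ l, Measurable (g l))
    (hf : ∀ l, S.eigenspace l ≠ ⊥ → Integrable (fun t => f l t ^ 2) ν ∧ ∫ t, f l t ^ 2 ∂ν ≤ C)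
    (hg : ∀ l, S.eigenspace l ≠ ⊥ → Integrable (fun t => g l t ^ 2) ν ∧ ∫ t, g l t ^ 2 ∂ν ≤ C')
    (hk : ∀ l m, k l m = ∫ t, f l t * g m t ∂ν) : ∃ Ψ, S.IsMultiplier k Ψ := by
  choose! F hF using fun l hl => exists_lp_of_integrable_sq (hfm l) (hf l hl).1
  choose! G hG using fun l hl => exists_lp_of_integrable_sq (hgm l) (hg l hl).1
  refine exists_isMultiplier (f := F) (g := G) (C := max √C √C')
    (fun l hl => (norm_le_of_ae (hF l hl) (hf l hl).2).trans (le_max_left _ _))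
    (fun l hl => (norm_le_of_ae (hG l hl) (hg l hl).2).trans (le_max_right _ _))
    fun l m hl hm => ?_
  rw [inner_eq_integral_of_ae (hF l hl) (hG m hm), hk]

theorem exists_isMultiplier_swap_of_integral {X : Type*} [MeasurableSpace X] {ν : Measure X}
    {k : ℝ → ℝ → ℝ} {f g : ℝ → X → ℝ} {C C' : ℝ}
    (hfm : ∀ l, Measurable (f l)) (hgm : ∀ l, Measurable (g l))
    (hf : ∀ l, S.eigenspace l ≠ ⊥ → Integrable (fun t => f l t ^ 2) ν ∧ ∫ t, f l t ^ 2 ∂ν ≤ C)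
    (hg : ∀ l, S.eigenspace l ≠ ⊥ → Integrable (fun t => g l t ^ 2) ν ∧ ∫ t, g l t ^ 2 ∂ν ≤ C')
    (hk : ∀ l m, k l m = ∫ t, f l t * g m t ∂ν) :
    (∃ Ψ, S.IsMultiplier k Ψ) ∧ ∃ Ψ, S.IsMultiplier (fun l m => k m l) Ψ :=
  ⟨exists_isMultiplier_of_integral hfm hgm hf hg hk,
    exists_isMultiplier_of_integral hgm hfm hg hf fun l m => by simp only [hk, mul_comm]⟩

theorem sign_sq_le_one (l : ℝ) : l.sign ^ 2 ≤ 1 := by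
  rcases Real.sign_apply_eq l with h | h | h <;> simp [h]

/-- The functions `|l|^s t^{3/2-s} (l² + t²)⁻¹` are bounded in `L²(0, ∞)`. -/
theorem exists_bound_balanced {s : ℝ} (h0 : 0 < s) (h2 : s < 2) (σ : ℝ → ℝ)
    (hσ : ∀ l, σ l ^ 2 ≤ 1) : ∃ C : ℝ, ∀ l : ℝ,
    IntegrableOn (fun t : ℝ =>
      (σ l * absNegPowFun (-s) l * t ^ ((3 - 2 * s) / 2) * (l ^ 2 + t ^ 2)⁻¹) ^ 2) (Ioi 0) ∧
    ∫ t in Ioi (0 : ℝ),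
      (σ l * absNegPowFun (-s) l * t ^ ((3 - 2 * s) / 2) * (l ^ 2 + t ^ 2)⁻¹) ^ 2 ≤ C := by
  set J := ∫ t in Ioi (0 : ℝ), t ^ (3 - 2 * s) * (1 + t ^ 2) ^ (-2 : ℝ) with hJ
  have hJ0 : 0 ≤ J := setIntegral_nonneg measurableSet_Ioi fun t ht => by
    have ht0 : 0 < t := ht
    positivity
  refine ⟨J, fun l => ?_⟩
  by_cases hl : l = 0
  · simp [hl, absNegPowFun_zero_right, hJ0]
  have hl' : 0 < |l| := abs_pos.2 hl
  have he : EqOn (fun t : ℝ =>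
      (σ l * absNegPowFun (-s) l * t ^ ((3 - 2 * s) / 2) * (l ^ 2 + t ^ 2)⁻¹) ^ 2)
      (fun t => σ l ^ 2 * |l| ^ (2 * s) * (t ^ (3 - 2 * s) * (l ^ 2 + t ^ 2) ^ (-2 : ℝ)))
      (Ioi 0) := fun t ht => by
    have ht0 : 0 < t := ht
    simp only
    rw [mul_pow, mul_pow, mul_pow, sq_rpow_half ht0.le, inv_sq_eq_rpow (by positivity),
      absNegPowFun_of_ne hl, neg_neg, ← sq_rpow_half hl'.le (2 * s),
      mul_div_cancel_left₀ s two_ne_zero]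
    ring
  have hi : IntegrableOn (fun t : ℝ => t ^ (3 - 2 * s) * (l ^ 2 + t ^ 2) ^ (-2 : ℝ)) (Ioi 0) :=
    integrableOn_radial (by linarith) (by norm_num) (by linarith) hl
  refine ⟨(integrableOn_congr_fun he measurableSet_Ioi).2 (hi.const_mul _), ?_⟩
  rw [setIntegral_congr_fun measurableSet_Ioi he, integral_const_mul, integral_radial hl, ← hJ,
    ← mul_assoc, mul_assoc (σ l ^ 2), ← Real.rpow_add hl']
  -- The powers of `|l|` cancel, so the `L²` norm depends on `l` only through `σ l`.
  rw [show 2 * s + (3 - 2 * s + 1 - 2 * 2) = 0 by ring, Real.rpow_zero, mul_one]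
  exact mul_le_of_le_one_left hJ0 (hσ l)

/-- The functions `l |l| (1 + t²)^{-e/2} (l² + t²)⁻¹` are bounded in `L²(0, ∞)`. -/
theorem exists_bound_unit {e : ℝ} (he : 1 / 2 < e) : ∃ C : ℝ, ∀ l : ℝ,
    IntegrableOn (fun t : ℝ =>
      (l.sign * absNegPowFun (-2) l * (1 + t ^ 2) ^ (-e / 2) * (l ^ 2 + t ^ 2)⁻¹) ^ 2) (Ioi 0) ∧
    ∫ t in Ioi (0 : ℝ),
      (l.sign * absNegPowFun (-2) l * (1 + t ^ 2) ^ (-e / 2) * (l ^ 2 + t ^ 2)⁻¹) ^ 2 ≤ C := by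
  have hi : IntegrableOn (fun t : ℝ => t ^ (0 : ℝ) * (1 + t ^ 2) ^ (-e)) (Ioi 0) :=
    integrableOn_rpow_mul_one_add_sq (by norm_num) (by linarith) (by linarith)
  refine ⟨∫ t in Ioi (0 : ℝ), t ^ (0 : ℝ) * (1 + t ^ 2) ^ (-e), fun l => ?_⟩
  have hle : ∀ t ∈ Ioi (0 : ℝ),
      (l.sign * absNegPowFun (-2) l * (1 + t ^ 2) ^ (-e / 2) * (l ^ 2 + t ^ 2)⁻¹) ^ 2
        ≤ t ^ (0 : ℝ) * (1 + t ^ 2) ^ (-e) := fun t ht => by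
    have ht0 : 0 < t := ht
    have h1 : absNegPowFun (-2) l = l ^ 2 := by
      by_cases hl : l = 0
      · simp [hl, absNegPowFun_zero_right]
      · rw [absNegPowFun_of_ne hl, neg_neg, Real.rpow_two, sq_abs]
    have h2 : (l ^ 2 * (l ^ 2 + t ^ 2)⁻¹) ^ 2 ≤ 1 := by
      refine pow_le_one₀ (by positivity) ?_
      rw [← div_eq_mul_inv]
      exact div_le_one_of_le₀ (by nlinarith) (by positivity)
    calc _ = l.sign ^ 2 * (l ^ 2 * (l ^ 2 + t ^ 2)⁻¹) ^ 2 * ((1 + t ^ 2) ^ (-e / 2)) ^ 2 := by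
          rw [h1]; ring
      _ ≤ 1 * 1 * ((1 + t ^ 2) ^ (-e / 2)) ^ 2 := by
          gcongr
          exact sign_sq_le_one l
      _ = _ := by rw [sq_rpow_half (by positivity), Real.rpow_zero, mul_one]
  have hi' : IntegrableOn (fun t : ℝ =>
      (l.sign * absNegPowFun (-2) l * (1 + t ^ 2) ^ (-e / 2) * (l ^ 2 + t ^ 2)⁻¹) ^ 2)
      (Ioi 0) := by
    refine Integrable.mono' hi (by fun_prop) ?_
    filter_upwards [ae_restrict_mem measurableSet_Ioi] with t ht
    rw [Real.norm_of_nonneg (by positivity)]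
    exact hle t ht
  exact ⟨hi', setIntegral_mono_on hi' hi measurableSet_Ioi hle⟩

/-- The functions `|m|^s t^{1-α} (1 + t²)^{e/2} (m² + t²)⁻¹`, where `e = 1/2 + α - s`, are bounded
in `L²(0, ∞)` when `|m|` stays away from zero. -/
theorem exists_bound_gap {α s c : ℝ} (hα : α ≤ 1) (h0 : 0 < s) (hs : s < α) (hc : 0 < c) :
    ∃ C : ℝ, ∀ m : ℝ, (m ≠ 0 → c ≤ |m|) →
    IntegrableOn (fun t : ℝ => (absNegPowFun (-s) m * t ^ (1 - α) *
      (1 + t ^ 2) ^ ((1 / 2 + α - s) / 2) * (m ^ 2 + t ^ 2)⁻¹) ^ 2) (Ioi 0) ∧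
    ∫ t in Ioi (0 : ℝ), (absNegPowFun (-s) m * t ^ (1 - α) *
      (1 + t ^ 2) ^ ((1 / 2 + α - s) / 2) * (m ^ 2 + t ^ 2)⁻¹) ^ 2 ≤ C := by
  -- With this value the total power of `|m|` after scaling is zero.
  set e := 1 / 2 + α - s with he
  set K := max 1 (c ^ 2)⁻¹ with hK
  set J := ∫ t in Ioi (0 : ℝ), t ^ (2 - 2 * α) * (1 + t ^ 2) ^ (-(2 - e)) with hJ
  have hK0 : 0 < K := lt_max_of_lt_left one_pos
  have hJ0 : 0 ≤ J := setIntegral_nonneg measurableSet_Ioi fun t ht => by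
    have ht0 : 0 < t := ht
    positivity
  refine ⟨K ^ e * J, fun m hm => ?_⟩
  by_cases hm0 : m = 0
  · simp only [hm0, absNegPowFun_zero_right, zero_mul, ne_eq, OfNat.ofNat_ne_zero,
      not_false_eq_true, zero_pow, integrableOn_zero, integral_zero, true_and]
    positivity
  have hm' : 0 < |m| := abs_pos.2 hm0
  have hi : IntegrableOn (fun t : ℝ => K ^ e * |m| ^ (2 * s) *
      (t ^ (2 - 2 * α) * (m ^ 2 + t ^ 2) ^ (-(2 - e)))) (Ioi 0) :=
    (integrableOn_radial (by linarith) (by linarith) (by linarith) hm0).const_mul _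
  have hle : ∀ t ∈ Ioi (0 : ℝ), (absNegPowFun (-s) m * t ^ (1 - α) *
      (1 + t ^ 2) ^ (e / 2) * (m ^ 2 + t ^ 2)⁻¹) ^ 2
        ≤ K ^ e * |m| ^ (2 * s) * (t ^ (2 - 2 * α) * (m ^ 2 + t ^ 2) ^ (-(2 - e))) :=
      fun t ht => by
    have ht0 : 0 < t := ht
    have hmt : 0 < m ^ 2 + t ^ 2 := by positivity
    -- The spectral gap enters here: it makes the weight comparable to a homogeneous function.
    have h1 : 1 + t ^ 2 ≤ K * (m ^ 2 + t ^ 2) := by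
      have h2 : 1 ≤ K * m ^ 2 := by
        have h3 : c ^ 2 ≤ m ^ 2 := by
          rw [← sq_abs m]
          gcongr
          exact hm hm0
        calc (1 : ℝ) = (c ^ 2)⁻¹ * c ^ 2 := by rw [inv_mul_cancel₀ (by positivity)]
          _ ≤ K * m ^ 2 := by
            gcongr
            exact le_max_right _ _
      have h4 : t ^ 2 ≤ K * t ^ 2 := le_mul_of_one_le_left (by positivity) (le_max_left _ _)
      linarith
    have h5 : t ^ (1 - α) = t ^ ((2 - 2 * α) / 2) := by congr 1; ring
    calc _ = |m| ^ (2 * s) * t ^ (2 - 2 * α) * (m ^ 2 + t ^ 2) ^ (-2 : ℝ) * (1 + t ^ 2) ^ e := by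
          rw [mul_pow, mul_pow, mul_pow, h5, sq_rpow_half ht0.le, inv_sq_eq_rpow hmt.le,
            sq_rpow_half (by positivity), absNegPowFun_of_ne hm0, neg_neg,
            ← sq_rpow_half hm'.le (2 * s), mul_div_cancel_left₀ s two_ne_zero]
          ring
      _ ≤ |m| ^ (2 * s) * t ^ (2 - 2 * α) * (m ^ 2 + t ^ 2) ^ (-2 : ℝ) *
            (K * (m ^ 2 + t ^ 2)) ^ e := by
          gcongr
          linarith
      _ = _ := by
          rw [Real.mul_rpow hK0.le hmt.le, neg_sub, sub_eq_add_neg e, Real.rpow_add hmt]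
          ring
  have hi' : IntegrableOn (fun t : ℝ => (absNegPowFun (-s) m * t ^ (1 - α) *
      (1 + t ^ 2) ^ (e / 2) * (m ^ 2 + t ^ 2)⁻¹) ^ 2) (Ioi 0) := by
    refine Integrable.mono' hi (by fun_prop) ?_
    filter_upwards [ae_restrict_mem measurableSet_Ioi] with t ht
    rw [Real.norm_of_nonneg (by positivity)]
    exact hle t ht
  refine ⟨hi', (setIntegral_mono_on hi' hi measurableSet_Ioi hle).trans (le_of_eq ?_)⟩
  rw [integral_const_mul, integral_radial hm0, ← hJ, mul_assoc (K ^ e), ← mul_assoc (|m| ^ (2 * s)),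
    ← Real.rpow_add hm', show 2 * s + (2 - 2 * α + 1 - 2 * (2 - e)) = 0 by rw [he]; ring,
    Real.rpow_zero, one_mul]

/-- The balance condition is what allows `t^{1-α}` to be split into the powers `t^{3/2-s}` for `s =
β + 1` and `s = γ`, each scale invariant. -/
theorem exists_isMultiplier_halfKernel_balanced {α β γ : ℝ} (h : β + γ = 1 + α) (hβ : -1 < β)
    (hβ' : β < 1) (hγ : 0 < γ) (hγ' : γ < 2) :
    (∃ Ψ, S.IsMultiplier (halfKernel α β γ) Ψ) ∧
      ∃ Ψ, S.IsMultiplier (fun l m => halfKernel α β γ m l) Ψ := by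
  obtain ⟨C, hC⟩ := exists_bound_balanced (s := β + 1) (by linarith) (by linarith) Real.sign
    sign_sq_le_one
  obtain ⟨C', hC'⟩ := exists_bound_balanced hγ hγ' (fun _ => 1) (by simp)
  refine exists_isMultiplier_swap_of_integral (ν := volume.restrict (Ioi 0))
    (fun l => by fun_prop) (fun l => by fun_prop) (fun l _ => hC l) (fun l _ => hC' l)
    fun l m => ?_
  rw [halfKernel, mul_absNegPowFun, resolventIntegral, ← integral_const_mul]
  refine setIntegral_congr_fun measurableSet_Ioi fun t ht => ?_
  have ht0 : 0 < t := ht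
  have h1 : t ^ (1 - α) = t ^ ((3 - 2 * (β + 1)) / 2) * t ^ ((3 - 2 * γ) / 2) := by
    rw [← Real.rpow_add ht0]
    congr 1
    linarith
  simp only [h1]
  ring

/-- For exponent `1` the balanced splitting would need `s = 2`, where integrability at `t = 0`
fails. Opposite powers of `1 + t²` are inserted in the two factors instead; the strict inequality `γ
< α` makes the first one square integrable. -/
theorem exists_isMultiplier_halfKernel_unit {α γ : ℝ} (hα : α ≤ 1) (hγ : 0 < γ) (hγ' : γ < α) :
    (∃ Ψ, S.IsMultiplier (halfKernel α 1 γ) Ψ) ∧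
      ∃ Ψ, S.IsMultiplier (fun l m => halfKernel α 1 γ m l) Ψ := by
  obtain ⟨c, hc, hgap⟩ := S.exists_gap
  obtain ⟨C, hC⟩ := exists_bound_unit (e := 1 / 2 + α - γ) (by linarith)
  obtain ⟨C', hC'⟩ := exists_bound_gap hα hγ hγ' hc
  refine exists_isMultiplier_swap_of_integral (ν := volume.restrict (Ioi 0))
    (fun l => by fun_prop) (fun l => by fun_prop) (fun l _ => hC l)
    (fun l hl => hC' l (hgap l hl)) fun l m => ?_
  rw [halfKernel, mul_absNegPowFun, one_add_one_eq_two, resolventIntegral, ← integral_const_mul]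
  refine setIntegral_congr_fun measurableSet_Ioi fun t ht => ?_
  have h1 : (1 + t ^ 2) ^ (-(1 / 2 + α - γ) / 2) * (1 + t ^ 2) ^ ((1 / 2 + α - γ) / 2) = 1 := by
    rw [← Real.rpow_add (by positivity), neg_div, neg_add_cancel, Real.rpow_zero]
  linear_combination (-(l.sign * absNegPowFun (-2) l * absNegPowFun (-γ) m * t ^ (1 - α) *
    (l ^ 2 + t ^ 2)⁻¹ * (m ^ 2 + t ^ 2)⁻¹)) * h1

/-- The kernel `halfKernel α β γ` and its transpose define multipliers, whose values are
approximable of any admissible order. -/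
theorem exists_isMultiplier_halfKernel {p : ℝ} (hp : 0 < p) (hS : S.IsSummable p) {α β γ θ : ℝ}
    (hα : α ∈ Ioc (0 : ℝ) 1) (hβ : β ∈ Icc (0 : ℝ) 1) (hγ : γ ∈ Icc (0 : ℝ) 1)
    (hθ : θ ≤ 1 + α - β - γ) (h0 : 0 ≤ θ) (h1 : β = 1 → 0 < θ ∧ θ < 1 + α - β - γ) :
    (∃ Ψ, S.IsMultiplier (halfKernel α β γ) Ψ ∧ IsApproximable (θ / p) Ψ) ∧
      ∃ Ψ, S.IsMultiplier (fun l m => halfKernel α β γ m l) Ψ ∧ IsApproximable (θ / p) Ψ := by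
  have key : ∀ {a b : ℝ}, 0 ≤ a → 0 ≤ b → θ ≤ a + b →
      ((∃ Ψ, S.IsMultiplier (halfKernel α (β + a) (γ + b)) Ψ) ∧
        ∃ Ψ, S.IsMultiplier (fun l m => halfKernel α (β + a) (γ + b) m l) Ψ) →
      (∃ Ψ, S.IsMultiplier (halfKernel α β γ) Ψ ∧ IsApproximable (θ / p) Ψ) ∧
        ∃ Ψ, S.IsMultiplier (fun l m => halfKernel α β γ m l) Ψ ∧ IsApproximable (θ / p) Ψ := by
    rintro a b ha hb hab ⟨⟨Ψ, hΨ⟩, Ψ', hΨ'⟩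
    refine ⟨⟨S.sandwich a b ∘L Ψ, ?_, ?_⟩, S.sandwich b a ∘L Ψ', ?_, ?_⟩
    · exact (hΨ.sandwich ha hb).congr fun l m _ _ => (halfKernel_eq α β γ a b l m).symm
    · refine (isApproximable_sandwich hp hS ha hb Ψ).mono ?_
      gcongr
    · refine (hΨ'.sandwich hb ha).congr fun l m _ _ => ?_
      rw [halfKernel_eq α β γ a b m l]
      ring
    · refine (isApproximable_sandwich hp hS hb ha Ψ').mono ?_
      rw [add_comm b a]
      gcongr
  obtain ⟨hα0, hα1⟩ := hα
  obtain ⟨hβ0, hβ1⟩ := hβ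
  obtain ⟨hγ0, hγ1⟩ := hγ
  rcases hβ1.lt_or_eq with hlt | rfl
  -- The exponent on the left is raised to `max β (α - 1/2)`, and the right one to its balanced
  -- partner. The lower bound `α - 1/2` keeps that partner below `2`, which matters for `α = 1`, `β
  -- = 0`.
  · have hm1 := le_max_left β (α - 1 / 2)
    have hm2 := le_max_right β (α - 1 / 2)
    have hm3 : max β (α - 1 / 2) < 1 := max_lt hlt (by linarith)
    have hm4 : max β (α - 1 / 2) ≤ 1 + α - γ := max_le (by linarith) (by linarith)
    refine key (a := max β (α - 1 / 2) - β) (b := 1 + α - max β (α - 1 / 2) - γ)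
      (by linarith) (by linarith) (by linarith)
      (exists_isMultiplier_halfKernel_balanced (by ring) ?_ ?_ ?_ ?_) <;> linarith
  · obtain ⟨h2, h3⟩ := h1 rfl
    -- The left exponent is already `1`, so the whole order `θ` is taken on the right.
    have h4 := key (a := 0) (b := θ) le_rfl h0 (by linarith)
    rw [add_zero] at h4
    exact h4 (exists_isMultiplier_halfKernel_unit hα1 (by linarith) (by linarith))

end Factorization

end SpectralTriple

end

noncomputable section

namespace SpectralTriple

variable {A : Type*} [Ring A] [StarRing A] [Algebra ℂ A]
  {H : Type*} [NormedAddCommGroup H] [InnerProductSpace ℂ H] [CompleteSpace H]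
  {S : SpectralTriple A H}

/-! ### The factorization -/

/-- The symbol `|l|^β |m|^γ (|l|^{-α} - |m|^{-α}) / (l - m)`, written as an integral; it vanishes
for `l = 0` and for `m = 0`. -/
def factorKernel (α β γ l m : ℝ) : ℝ :=
  -(resolventConst α)⁻¹ * (halfKernel α β γ l m + halfKernel α γ β m l)

/-- The two half kernels sum to `(l + m) |l|^β |m|^γ` times the symmetric resolvent integral, and
`-(l - m) (l + m) = m² - l²`. -/
theorem sub_mul_factorKernel {α : ℝ} (h0 : 0 < α) (h2 : α < 2) (β γ : ℝ) {l m : ℝ}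
    (hl : l ≠ 0) (hm : m ≠ 0) :
    (l - m) * (absNegPowFun β l * factorKernel α β γ l m * absNegPowFun γ m)
      = |l| ^ (-α) - |m| ^ (-α) := by
  have hJ := (resolventConst_pos h0 h2).ne'
  have h1 := sub_mul_resolventIntegral h0 h2 hl hm
  have hone : ∀ {x : ℝ}, x ≠ 0 → ∀ q : ℝ, absNegPowFun q x * absNegPowFun (-q) x = 1 := by
    intro x hx q
    rw [absNegPowFun_mul, add_neg_cancel, absNegPowFun_of_ne hx, neg_zero, Real.rpow_zero]
  have h3 := hone hl β
  have h4 := hone hm γ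
  unfold factorKernel halfKernel
  rw [resolventIntegral_comm α m l]
  calc _ = (absNegPowFun β l * absNegPowFun (-β) l) * (absNegPowFun γ m * absNegPowFun (-γ) m) *
        ((resolventConst α)⁻¹ * ((m ^ 2 - l ^ 2) * resolventIntegral α l m)) := by ring
    _ = _ := by rw [h3, h4, h1, inv_mul_cancel_left₀ hJ, one_mul, one_mul]

/-- One half kernel is critical at `β = 1`, the other at `γ = 1`; hence the restriction through `max
β γ`. -/
theorem exists_isMultiplier_factorKernel {p : ℝ} (hp : 0 < p) (hS : S.IsSummable p)
    {α β γ θ : ℝ} (hα : α ∈ Set.Ioc (0 : ℝ) 1) (hβ : β ∈ Set.Icc (0 : ℝ) 1)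
    (hγ : γ ∈ Set.Icc (0 : ℝ) 1) (h0 : 0 ≤ θ) (hθ : θ ≤ 1 + α - β - γ)
    (h1 : max β γ = 1 → 0 < θ ∧ θ < 1 + α - β - γ) :
    ∃ Φ, S.IsMultiplier (factorKernel α β γ) Φ ∧ IsApproximable (θ / p) Φ := by
  obtain ⟨⟨Ψ, hΨ, hΨ'⟩, -⟩ := exists_isMultiplier_halfKernel hp hS hα hβ hγ hθ h0
    fun h => h1 (by rw [h, max_eq_left hγ.2])
  obtain ⟨-, Ψ₂, hΨ₂, hΨ₂'⟩ := exists_isMultiplier_halfKernel hp hS hα hγ hβ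
    (by linarith : θ ≤ 1 + α - γ - β) h0 fun h => by
      have := h1 (by rw [h, max_eq_right hβ.2])
      exact ⟨this.1, by linarith⟩
  exact ⟨_, (hΨ.add hΨ₂).smul _, (hΨ'.add (by positivity) hΨ₂').smul _⟩

theorem sign_apply_of_mem {l : ℝ} {x : H} (hx : x ∈ S.eigenspace l) :
    S.sign x = (l.sign : ℂ) • x :=
  S.funCalc_apply_of_mem S.bounded_sign hx

theorem inner_sign_of_mem {l : ℝ} {y : H} (hy : y ∈ S.eigenspace l) (x : H) :
    inner ℂ y (S.sign x) = l.sign * inner ℂ y x :=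
  S.inner_funCalc_of_mem S.bounded_sign hy x

theorem mul_sign_mul_absNegPowFun {l : ℝ} (hl : l ≠ 0) (α : ℝ) :
    l * (absNegPowFun (α + 1) l * l.sign) = |l| ^ (-α) := by
  have hl' := abs_pos.2 hl
  have h : l * l.sign = |l| := by
    rcases lt_or_gt_of_ne hl with h | h
    · rw [Real.sign_of_neg h, abs_of_neg h]; ring
    · rw [Real.sign_of_pos h, abs_of_pos h, mul_one]
  rw [mul_left_comm, h, absNegPowFun_of_ne hl, neg_add, Real.rpow_add hl', Real.rpow_neg_one,
    mul_assoc, inv_mul_cancel₀ hl'.ne', mul_one]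

/-- A multiplier whose kernel has the right divided differences satisfies the factorization
formula. -/
theorem IsMultiplier.commutator_eq {k : ℝ → ℝ → ℝ} {Φ : (H →L[ℂ] H) →L[ℂ] (H →L[ℂ] H)}
    (hΦ : S.IsMultiplier k Φ) {α β γ : ℝ} (hα : 0 ≤ α) (hβ : 0 ≤ β) (hγ : 0 ≤ γ)
    (hk : ∀ l m, l ≠ 0 → m ≠ 0 →
      (l - m) * (absNegPowFun β l * k l m * absNegPowFun γ m) = |l| ^ (-α) - |m| ^ (-α))
    (a : A) :
    S.absNegPow α * S.π a - S.π a * S.absNegPow α =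
      S.absNegPow β * Φ (S.comm a) * S.absNegPow γ
        + S.absNegPow (α + 1) * S.sign * S.comm a * S.kerProj
        + S.kerProj * S.comm a * S.sign * S.absNegPow (α + 1) := by
  refine S.ext_inner_eigenspace fun l m y hy x hx => ?_
  have hα1 : 0 ≤ α + 1 := by linarith
  -- Since the powers vanish at `0`, exactly one term on the right survives unless `l = m = 0`: the
  -- divided difference for `l, m ≠ 0`, and one of the two kernel corrections if one eigenvalue is
  -- zero.
  have hreal : absNegPowFun α l - absNegPowFun α m
      = (l - m) * (absNegPowFun β l * k l m * absNegPowFun γ m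
        + absNegPowFun (α + 1) l * l.sign * (if m = 0 then 1 else 0)
        + (if l = 0 then 1 else 0) * m.sign * absNegPowFun (α + 1) m) := by
    by_cases hl : l = 0
    · by_cases hm : m = 0
      · simp [hl, hm]
      · have := mul_sign_mul_absNegPowFun hm α
        simp only [hl, hm, absNegPowFun_zero_right, if_true, if_false, absNegPowFun_of_ne hm α]
        linear_combination this
    · by_cases hm : m = 0
      · have := mul_sign_mul_absNegPowFun hl α
        simp only [hl, hm, absNegPowFun_zero_right, if_true, if_false, absNegPowFun_of_ne hl α]
        linear_combination -this
      · simp only [hl, hm, if_false, absNegPowFun_of_ne hl α, absNegPowFun_of_ne hm α]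
        linear_combination -hk l m hl hm
  have hcomplex : (absNegPowFun α l : ℂ) - absNegPowFun α m
      = ((l : ℂ) - m) * (absNegPowFun β l * k l m * absNegPowFun γ m
        + absNegPowFun (α + 1) l * l.sign * (if m = 0 then 1 else 0)
        + (if l = 0 then 1 else 0) * m.sign * absNegPowFun (α + 1) m) := by
    have h1 := congrArg Complex.ofReal hreal
    split_ifs at h1 ⊢ <;> exact_mod_cast h1
  simp only [_root_.add_apply, _root_.sub_apply, mul_apply_eq_comp, inner_add_right,
    inner_sub_right, S.inner_absNegPow_of_mem hα hy, S.absNegPow_apply_of_mem hα hx,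
    S.inner_absNegPow_of_mem hβ hy, S.absNegPow_apply_of_mem hγ hx,
    S.inner_absNegPow_of_mem hα1 hy, S.absNegPow_apply_of_mem hα1 hx, S.inner_kerProj_of_mem hy,
    S.kerProj_apply_of_mem hx, inner_sign_of_mem hy, sign_apply_of_mem hx, map_smul,
    inner_smul_right, hΦ _ l m y hy x hx, S.inner_comm_of_mem a hy hx]
  linear_combination (inner ℂ y (S.π a x)) * hcomplex

/-- Existence of the factorizing operator, together with its approximation orders. -/
theorem exists_factorization {p : ℝ} (hp : 0 < p) (hS : S.IsSummable p) {α β γ : ℝ}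
    (hα : α ∈ Set.Icc (0 : ℝ) 1) (hβ : β ∈ Set.Icc (0 : ℝ) 1) (hγ : γ ∈ Set.Icc (0 : ℝ) 1)
    (h : β + γ < α + 1 ∨ (β + γ = α + 1 ∧ max β γ < 1)) :
    ∃ Φ : (H →L[ℂ] H) →L[ℂ] (H →L[ℂ] H),
      (∀ a : A,
        S.absNegPow α * S.π a - S.π a * S.absNegPow α =
          S.absNegPow β * Φ (S.comm a) * S.absNegPow γ
            + S.absNegPow (α + 1) * S.sign * S.comm a * S.kerProj
            + S.kerProj * S.comm a * S.sign * S.absNegPow (α + 1)) ∧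
      ∀ θ : ℝ, 0 ≤ θ → θ ≤ 1 + α - β - γ → (max β γ = 1 → 0 < θ ∧ θ < 1 + α - β - γ) →
        IsApproximable (θ / p) Φ := by
  -- For `α = 0` the constant integral diverges, but `|D|^0 = 1 - Π₀` has no differences off `ker
  -- D`, so `Φ = 0` works.
  rcases hα.1.eq_or_lt with rfl | hα0
  · have h0 : S.IsMultiplier (fun _ _ => 0) (0 : (H →L[ℂ] H) →L[ℂ] (H →L[ℂ] H)) :=
      fun T l m y _ x _ => by simp
    refine ⟨0, h0.commutator_eq le_rfl hβ.1 hγ.1 fun l m _ _ => by simp, fun θ _ _ _ =>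
      isApproximable_zero _⟩
  · have hex : ∃ θ : ℝ, 0 ≤ θ ∧ θ ≤ 1 + α - β - γ ∧
        (max β γ = 1 → 0 < θ ∧ θ < 1 + α - β - γ) := by
      rcases h with h | ⟨h, h'⟩
      · exact ⟨(1 + α - β - γ) / 2, by linarith, by linarith,
          fun _ => ⟨by linarith, by linarith⟩⟩
      · exact ⟨0, le_rfl, by linarith, fun h1 => absurd h1 h'.ne⟩
    obtain ⟨θ₀, h1, h2, h3⟩ := hex
    have hα' : α ∈ Set.Ioc (0 : ℝ) 1 := ⟨hα0, hα.2⟩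
    obtain ⟨Φ, hΦ, -⟩ := exists_isMultiplier_factorKernel hp hS hα' hβ hγ h1 h2 h3
    refine ⟨Φ, hΦ.commutator_eq hα.1 hβ.1 hγ.1 fun l m hl hm =>
      sub_mul_factorKernel hα0 (by linarith [hα.2]) β γ hl hm, fun θ hθ0 hθ hθ1 => ?_⟩
    -- `Φ` was fixed using some admissible `θ₀`; the multiplier built for `θ` has the same kernel
    -- and so coincides with it.
    obtain ⟨Φ', hΦ', happ⟩ := exists_isMultiplier_factorKernel hp hS hα' hβ hγ hθ0 hθ hθ1
    rwa [hΦ.unique hΦ']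

end SpectralTriple

end

/-! ### From approximation orders to weak Schatten classes -/

theorem mainTheorem6 {A : Type*} [Ring A] [StarRing A] [Algebra ℂ A] [StarModule ℂ A]
    {H : Type*} [NormedAddCommGroup H] [InnerProductSpace ℂ H] [CompleteSpace H]
    [TopologicalSpace.SeparableSpace H]
    (S : SpectralTriple A H) (p : ℝ) (hp : 0 < p) (hS : S.IsSummable p)
    (α β γ : ℝ) (hα : α ∈ Set.Icc (0 : ℝ) 1) (hβ : β ∈ Set.Icc (0 : ℝ) 1)
    (hγ : γ ∈ Set.Icc (0 : ℝ) 1)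
    (h : β + γ < α + 1 ∨ (β + γ = α + 1 ∧ max β γ < 1)) :
    ∃ Φ : (H →L[ℂ] H) →L[ℂ] (H →L[ℂ] H),
      (∀ a : A,
        S.absNegPow α * S.π a - S.π a * S.absNegPow α =
          S.absNegPow β * Φ (S.comm a) * S.absNegPow γ
            + S.absNegPow (α + 1) * S.sign * S.comm a * S.kerProj
            + S.kerProj * S.comm a * S.sign * S.absNegPow (α + 1)) ∧
      (β + γ < α + 1 →
        (max β γ < 1 → BoundedIntoWeakSchatten Φ (p / (1 + α - β - γ))) ∧
        (max β γ = 1 → ∀ r : ℝ, p / (1 + α - β - γ) < r → BoundedIntoWeakSchatten Φ r) ∧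
        (∀ T : H →L[ℂ] H, IsCompactOperator (Φ T))) := by
  obtain ⟨Φ, hΦ, happ⟩ := SpectralTriple.exists_factorization hp hS hα hβ hγ h
  refine ⟨Φ, hΦ, fun hlt => ?_⟩
  have hδ : 0 < 1 + α - β - γ := by linarith
  have hr0 : 0 < p / (1 + α - β - γ) := by positivity
  have hlt_one : max β γ < 1 → BoundedIntoWeakSchatten Φ (p / (1 + α - β - γ)) := fun hmax => by
    refine IsApproximable.boundedIntoWeakSchatten hr0 ?_
    rw [one_div_div]
    exact happ _ hδ.le le_rfl fun h1 => absurd h1 hmax.ne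
  have heq_one : max β γ = 1 → ∀ r : ℝ, p / (1 + α - β - γ) < r → BoundedIntoWeakSchatten Φ r :=
    fun _ r hr => by
    have hr' : 0 < r := hr0.trans hr
    refine IsApproximable.boundedIntoWeakSchatten hr' ?_
    have hpr : p / r < 1 + α - β - γ := by
      rw [div_lt_iff₀ hr', mul_comm]
      exact (div_lt_iff₀ hδ).1 hr
    -- The order `θ = p / r` gives `θ / p = 1 / r`, and `r > p / (1 + α - β - γ)` is precisely the
    -- strictness demanded at the endpoint.
    have h1 := happ (p / r) (by positivity) hpr.le fun _ => ⟨by positivity, hpr⟩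
    rwa [div_right_comm, div_self hp.ne'] at h1
  refine ⟨hlt_one, heq_one, fun T => ?_⟩
  rcases (max_le hβ.2 hγ.2).lt_or_eq with hmax | hmax
  · exact ((hlt_one hmax).1 T).1
  · exact ((heq_one hmax _ (lt_add_one _)).1 T).1
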